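/- Let $n>1$, let $B=\{z\in\mathbb C^n:|z|<1\}$, and let $\sigma$ denote $(2n-1)$-dimensional Hausdorff measure. For $P\in\partial B$ and $\alpha>1$ put $$\Gamma_\alpha(P)=\{z\in B:|z-P|<\alpha(1-|z|)\},\qquad \mathcal A_\alpha(P)=\Bigl\{z\in B:\Bigl|1-\sum_j z_j\overline{P_j}\Bigr|<\alpha(1-|z|)\Bigr\}.$$ A function $f:B\to\mathbb C$ is called nontangentially bounded at $P$ if there is an $\alpha=\alpha(P)>1$ such that $f$ is bounded on $\Gamma_\alpha(P)$, and admissibly bounded at $P$ if there is an $\alpha=\alpha(P)>1$ such that $f$ is bounded on $\mathcal A_\alpha(P)$. (i) Let $f$ be holomorphic on $B$ and let $E\subseteq\partial B$ be a set with $\sigma(E)>0$. Then $f$ is nontangentially bounded at $\sigma$-almost every point of $E$ if and only if $f$ is admissibly bounded at $\sigma$-almost every point of $E$. (ii) The equivalence fails point by point: for every $P\in\partial B$ there is a holomorphic function on $B$ that is nontangentially bounded at $P$ but not admissibly bounded at $P$. -/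

import Mathlib

open scoped MeasureTheory

/-- The Stolz (nontangential) approach region of aperture `α` at the boundary point `P` of the
unit ball of `ℂⁿ`: the points `z` of the ball with `|z - P| < α (1 - |z|)`; here `1 - |z|` is the
Euclidean distance from `z` to the unit sphere. -/
def stolzRegion {n : ℕ} (α : ℝ) (P : EuclideanSpace ℂ (Fin n)) :
    Set (EuclideanSpace ℂ (Fin n)) :=
  {z | z ∈ Metric.ball (0 : EuclideanSpace ℂ (Fin n)) 1 ∧ ‖z - P‖ < α * (1 - ‖z‖)}

/-- The admissible (Korányi) approach region of aperture `α` at the boundary point `P` of the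
unit ball of `ℂⁿ`: the points `z` of the ball with `|1 - z · P̄| < α (1 - |z|)`, where
`z · P̄ = ∑ j, z j * conj (P j)`. -/
def koranyiRegion {n : ℕ} (α : ℝ) (P : EuclideanSpace ℂ (Fin n)) :
    Set (EuclideanSpace ℂ (Fin n)) :=
  {z | z ∈ Metric.ball (0 : EuclideanSpace ℂ (Fin n)) 1 ∧
    ‖1 - ∑ j, z j * (starRingEnd ℂ) (P j)‖ < α * (1 - ‖z‖)}

/-- `f` is nontangentially bounded at `P`: it is bounded on the Stolz region at `P` of some
aperture `α > 1`. Aperture and bound may depend on `P`. -/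
def NontangentiallyBoundedAt {n : ℕ} (f : EuclideanSpace ℂ (Fin n) → ℂ)
    (P : EuclideanSpace ℂ (Fin n)) : Prop :=
  ∃ α : ℝ, 1 < α ∧ ∃ M : ℝ, ∀ z ∈ stolzRegion α P, ‖f z‖ ≤ M

/-- `f` is admissibly bounded at `P`: it is bounded on the Korányi region at `P` of some
aperture `α > 1`. Aperture and bound may depend on `P`. -/
def AdmissiblyBoundedAt {n : ℕ} (f : EuclideanSpace ℂ (Fin n) → ℂ)
    (P : EuclideanSpace ℂ (Fin n)) : Prop :=
  ∃ α : ℝ, 1 < α ∧ ∃ M : ℝ, ∀ z ∈ koranyiRegion α P, ‖f z‖ ≤ M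

/-! Admissible boundedness implies nontangential boundedness at each single point, because `|1 - ⟨P,
z⟩| ≤ ‖z - P‖`. For the converse, closed sets `F` on which aperture and bound are uniform exhaust
the points of nontangential boundedness, so it suffices to treat almost every `P ∈ F`.

Let `z = (1 - h) • Q` lie in a Korányi region at such a `P`. In the complex tangential directions
that region is about `√h` wide, so `z` may be far from every Stolz region over `F`. However, `P` is
a density point of `F` for the nonisotropic balls of the sphere, whose surface measure is doubling.
Hence some tangential circle `Q + l • v`, with `‖v‖` of order `√h`, lies within `γ * h` of `F`
except on a small part (`ae_exists_tangential_circle`). A holomorphic function `r` with small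
positive mean real part marks that part. It also pushes the disc through `z` inwards there
(`norm_le_of_disc`). On the good part of the boundary the disc lies in Stolz regions over `F`, so
`|f| ≤ M`. On the bad part it stays in the same Korányi region, no lower than `z`, so the current
bound `M + D` applies. The mean value property then improves `M + D` to `M + D / 2`. Iteration gives
`M` (`admissiblyBoundedAt_of_tangential_circle`). Since `γ` may be small compared with `α - 1`,
every aperture `α > 1` suffices.

For the counterexample, `⟨Q, z⟩` with `Q ⟂ P` is of order `1 - ‖z‖` in Stolz regions but can reach
order `√(1 - ‖z‖)` in Korányi regions. -/

/-! ### Comparison of the approach regions and the pointwise counterexample. -/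

theorem sum_mul_conj_eq_inner {n : ℕ} (z P : EuclideanSpace ℂ (Fin n)) :
    ∑ j, z j * (starRingEnd ℂ) (P j) = inner ℂ P z := by
  simp [PiLp.inner_apply]

theorem norm_one_sub_inner_le {E : Type*} [NormedAddCommGroup E] [InnerProductSpace ℂ E]
    {P : E} (hP : ‖P‖ = 1) (z : E) : ‖1 - inner ℂ P z‖ ≤ ‖z - P‖ := by
  have h1 : (inner ℂ P P : ℂ) = 1 := by rw [inner_self_eq_norm_sq_to_K, hP]; simp
  calc ‖1 - inner ℂ P z‖ = ‖inner ℂ P (P - z)‖ := by rw [inner_sub_right, h1]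
    _ ≤ ‖P‖ * ‖P - z‖ := norm_inner_le_norm _ _
    _ = ‖z - P‖ := by rw [hP, one_mul, norm_sub_rev]

theorem stolzRegion_subset_koranyiRegion {n : ℕ} (α : ℝ) {P : EuclideanSpace ℂ (Fin n)}
    (hP : ‖P‖ = 1) : stolzRegion α P ⊆ koranyiRegion α P := by
  rintro z ⟨hz, h⟩
  refine ⟨hz, ?_⟩
  rw [sum_mul_conj_eq_inner]
  exact (norm_one_sub_inner_le hP z).trans_lt h

theorem AdmissiblyBoundedAt.nontangentiallyBoundedAt {n : ℕ}
    {f : EuclideanSpace ℂ (Fin n) → ℂ} {P : EuclideanSpace ℂ (Fin n)} (hP : ‖P‖ = 1)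
    (h : AdmissiblyBoundedAt f P) : NontangentiallyBoundedAt f P := by
  obtain ⟨α, hα, M, hM⟩ := h
  exact ⟨α, hα, M, fun z hz => hM z (stolzRegion_subset_koranyiRegion α hP hz)⟩

theorem exists_norm_one_inner_eq_zero {n : ℕ} (hn : 1 < n) (P : EuclideanSpace ℂ (Fin n)) :
    ∃ Q : EuclideanSpace ℂ (Fin n), ‖Q‖ = 1 ∧ inner ℂ P Q = 0 := by
  have h1 : Module.finrank ℂ (Submodule.span ℂ {P}) < Module.finrank ℂ
      (EuclideanSpace ℂ (Fin n)) := by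
    rw [finrank_euclideanSpace_fin]
    exact ((finrank_span_le_card (R := ℂ) {P}).trans (by simp)).trans_lt hn
  have h2 : (Submodule.span ℂ {P})ᗮ ≠ ⊥ := by
    intro h
    rw [Submodule.orthogonal_eq_bot_iff] at h
    rw [h, finrank_top] at h1
    exact lt_irrefl _ h1
  obtain ⟨x, hx, hx0⟩ := Submodule.exists_mem_ne_zero_of_ne_bot h2
  refine ⟨((‖x‖ : ℂ)⁻¹) • x, by rw [norm_smul]; simp [norm_ne_zero_iff.2 hx0], ?_⟩
  rw [inner_smul_right, Submodule.mem_orthogonal_singleton_iff_inner_right.1 hx, mul_zero]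

theorem norm_inner_lt_one {E : Type*} [NormedAddCommGroup E] [InnerProductSpace ℂ E]
    {P z : E} (hP : ‖P‖ = 1) (hz : ‖z‖ < 1) : ‖(inner ℂ P z : ℂ)‖ < 1 :=
  (norm_inner_le_norm P z).trans_lt (by rwa [hP, one_mul])

theorem one_sub_inner_ne_zero {E : Type*} [NormedAddCommGroup E] [InnerProductSpace ℂ E]
    {P z : E} (hP : ‖P‖ = 1) (hz : ‖z‖ < 1) : (1 - inner ℂ P z : ℂ) ≠ 0 := by
  intro h
  have := norm_inner_lt_one hP hz
  rw [← sub_eq_zero.1 h] at this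
  simp at this

theorem exists_nontangentiallyBoundedAt_not_admissiblyBoundedAt {n : ℕ} (hn : 1 < n)
    {P : EuclideanSpace ℂ (Fin n)} (hP : ‖P‖ = 1) :
    ∃ f : EuclideanSpace ℂ (Fin n) → ℂ,
      DifferentiableOn ℂ f (Metric.ball (0 : EuclideanSpace ℂ (Fin n)) 1) ∧
        NontangentiallyBoundedAt f P ∧ ¬ AdmissiblyBoundedAt f P := by
  obtain ⟨Q, hQ, hPQ⟩ := exists_norm_one_inner_eq_zero hn P
  have hPP : (inner ℂ P P : ℂ) = 1 := by rw [inner_self_eq_norm_sq_to_K, hP]; simp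
  have hQQ : (inner ℂ Q Q : ℂ) = 1 := by rw [inner_self_eq_norm_sq_to_K, hQ]; simp
  have hQP : (inner ℂ Q P : ℂ) = 0 := inner_eq_zero_symm.1 hPQ
  -- At height `h` this is `O(h ^ 3 / h ^ 2)` in the Stolz region, but reaches order `h ^ (3 / 2) /
  -- h ^ 2` in every Korányi region.
  refine ⟨fun z => (inner ℂ Q z) ^ 3 / (1 - inner ℂ P z) ^ 2, ?_, ?_, ?_⟩
  · intro z hz
    have hz1 : ‖z‖ < 1 := by simpa using hz
    have h1 : DifferentiableAt ℂ (fun z => (inner ℂ Q z : ℂ)) z :=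
      (innerSL ℂ Q).differentiableAt
    have h2 : DifferentiableAt ℂ (fun z => (inner ℂ P z : ℂ)) z :=
      (innerSL ℂ P).differentiableAt
    have h3 : DifferentiableAt ℂ (fun z => (1 - inner ℂ P z : ℂ) ^ 2) z :=
      (h2.const_sub 1).fun_pow 2
    have h4 : DifferentiableAt ℂ (fun z => (inner ℂ Q z : ℂ) ^ 3) z := h1.fun_pow 3
    simp only [div_eq_mul_inv]
    exact (h4.fun_mul (h3.fun_inv
      (pow_ne_zero 2 (one_sub_inner_ne_zero hP hz1)))).differentiableWithinAt
  · refine ⟨2, by norm_num, 8, ?_⟩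
    rintro z ⟨hz, h⟩
    have hz1 : ‖z‖ < 1 := by simpa using hz
    have h1 : ‖(inner ℂ Q z : ℂ)‖ ≤ 2 * (1 - ‖z‖) := by
      have : (inner ℂ Q z : ℂ) = inner ℂ Q (z - P) := by rw [inner_sub_right, hQP, sub_zero]
      rw [this]
      refine (norm_inner_le_norm _ _).trans ?_
      rw [hQ, one_mul]; exact h.le
    have h2 : 1 - ‖z‖ ≤ ‖(1 - inner ℂ P z : ℂ)‖ := by
      have h3 := norm_sub_norm_le (1 : ℂ) (inner ℂ P z)
      have h4 : ‖(inner ℂ P z : ℂ)‖ ≤ ‖z‖ := by simpa [hP] using norm_inner_le_norm (𝕜 := ℂ) P z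
      rw [norm_one] at h3; linarith
    have h0 : 0 < 1 - ‖z‖ := by linarith
    rw [norm_div, norm_pow, norm_pow, div_le_iff₀ (pow_pos (h0.trans_le h2) 2)]
    calc ‖(inner ℂ Q z : ℂ)‖ ^ 3 ≤ (2 * (1 - ‖z‖)) ^ 3 := by gcongr
      _ = 8 * (1 - ‖z‖) ^ 2 * (1 - ‖z‖) := by ring
      _ ≤ 8 * (1 - ‖z‖) ^ 2 * 1 := by gcongr; linarith [norm_nonneg z]
      _ ≤ 8 * ‖(1 - inner ℂ P z : ℂ)‖ ^ 2 := by rw [mul_one]; gcongr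
  · rintro ⟨β, hβ, M, hM⟩
    -- With `1 - c = 1 / β`, the point `(1 - s) • P + √(c * s) • Q` lies in the Korányi region of
    -- aperture `β` for every `s < c`.
    set c : ℝ := 1 - 1 / β with hc
    have hβ0 : 0 < β := by linarith
    have hβ1 : 1 / β < 1 := by rw [div_lt_one hβ0]; exact hβ
    have hβ2 : 0 < 1 / β := by positivity
    have hc0 : 0 < c := by linarith
    have key : ∀ s : ℝ, 0 < s → s < c → c ^ 3 ≤ M ^ 2 * s := by
      intro s hs hsc
      set w : ℝ := Real.sqrt (c * s) with hw
      have hw2 : w ^ 2 = c * s := Real.sq_sqrt (by positivity)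
      have hw0 : 0 < w := Real.sqrt_pos.2 (by positivity)
      set z : EuclideanSpace ℂ (Fin n) := ((1 - s : ℝ) : ℂ) • P + (w : ℂ) • Q with hz
      have hPz : (inner ℂ P z : ℂ) = ((1 - s : ℝ) : ℂ) := by
        rw [hz, inner_add_right, inner_smul_right, inner_smul_right, hPP, hPQ]; simp
      have hQz : (inner ℂ Q z : ℂ) = (w : ℂ) := by
        rw [hz, inner_add_right, inner_smul_right, inner_smul_right, hQQ, hQP]; simp
      have hnz : ‖z‖ ^ 2 = (1 - s) ^ 2 + c * s := by
        have h1 := norm_add_sq_eq_norm_sq_add_norm_sq_of_inner_eq_zero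
          (((1 - s : ℝ) : ℂ) • P) ((w : ℂ) • Q) (𝕜 := ℂ)
          (by rw [inner_smul_left, inner_smul_right, hPQ]; simp)
        rw [← hz, norm_smul, norm_smul, hP, hQ, Complex.norm_real, Complex.norm_real, mul_one,
          mul_one, Real.norm_eq_abs, Real.norm_eq_abs] at h1
        nlinarith [abs_mul_abs_self (1 - s), abs_mul_abs_self w]
      -- The left side is `(1 - ‖z‖ ^ 2) / 2`.
      have h4 : s * (1 - s / 2 - c / 2) ≤ 1 - ‖z‖ := by nlinarith [sq_nonneg (1 - ‖z‖)]
      have h5 : s / β < s * (1 - s / 2 - c / 2) := by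
        rw [div_eq_mul_one_div]; exact mul_lt_mul_of_pos_left (by linarith) hs
      have h6 : 0 < s / β := by positivity
      have h7 := hM z ⟨by simpa using (by linarith : ‖z‖ < 1), by
        rw [sum_mul_conj_eq_inner, hPz]
        have : (1 - ((1 - s : ℝ) : ℂ)) = (s : ℂ) := by push_cast; ring
        rw [this, Complex.norm_real, Real.norm_eq_abs, abs_of_pos hs]
        calc s = β * (s / β) := by field_simp
          _ < β * (1 - ‖z‖) := mul_lt_mul_of_pos_left (by linarith) hβ0⟩
      simp only [hPz, hQz] at h7
      have h8 : (w : ℂ) ^ 3 / (1 - ((1 - s : ℝ) : ℂ)) ^ 2 = ((w ^ 3 / s ^ 2 : ℝ) : ℂ) := by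
        push_cast; ring
      rw [h8, Complex.norm_real, Real.norm_eq_abs, abs_of_pos (by positivity),
        div_le_iff₀ (by positivity)] at h7
      have h9 : (w ^ 3) ^ 2 ≤ (M * s ^ 2) ^ 2 := by gcongr
      have h10 : (w ^ 3) ^ 2 = c ^ 3 * s ^ 3 := by
        calc (w ^ 3) ^ 2 = (w ^ 2) ^ 3 := by ring
          _ = _ := by rw [hw2]; ring
      rw [h10] at h9
      have h11 : c ^ 3 * s ^ 3 ≤ (M ^ 2 * s) * s ^ 3 := by linarith [h9]
      exact le_of_mul_le_mul_right h11 (by positivity)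
    have hlim : Filter.Tendsto (fun s : ℝ => M ^ 2 * s) (nhdsWithin 0 (Set.Ioi 0))
        (nhds (M ^ 2 * 0)) :=
      ((continuous_const.mul continuous_id).tendsto 0).mono_left nhdsWithin_le_nhds
    have : c ^ 3 ≤ M ^ 2 * 0 := by
      refine ge_of_tendsto hlim ?_
      filter_upwards [Ioo_mem_nhdsGT hc0] with s hs using key s hs.1 hs.2
    have : 0 < c ^ 3 := by positivity
    linarith

/-! ### Holomorphic majorants and mean values on the circle. -/

/-- On the unit circle every trigonometric polynomial has the real part of an entire function. -/
theorem exists_entire_re_eq_and_im_eq_of_mem_span_fourier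
    (g : C(AddCircle (2 * Real.pi), ℂ))
    (hg : g ∈ Submodule.span ℂ (Set.range (@fourier (2 * Real.pi)))) :
    (∃ q : ℂ → ℂ, Differentiable ℂ q ∧
      ∀ θ : ℝ, (q (Complex.exp (θ * Complex.I))).re = (g θ).re) ∧
    (∃ q : ℂ → ℂ, Differentiable ℂ q ∧
      ∀ θ : ℝ, (q (Complex.exp (θ * Complex.I))).re = (g θ).im) := by
  induction hg using Submodule.span_induction with
  | mem x hx =>
    obtain ⟨m, rfl⟩ := hx
    have hval : ∀ θ : ℝ, fourier (T := 2 * Real.pi) m (θ : AddCircle (2 * Real.pi)) =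
        Complex.exp (m * (θ * Complex.I)) := by
      intro θ
      rw [fourier_coe_apply]
      congr 1
      have : (Real.pi : ℂ) ≠ 0 := by exact_mod_cast Real.pi_ne_zero
      push_cast
      field_simp
    rcases Int.eq_nat_or_neg m with ⟨k, rfl | rfl⟩
    · have hk : ∀ θ : ℝ, Complex.exp (((k : ℤ) : ℂ) * (θ * Complex.I)) =
          Complex.exp (θ * Complex.I) ^ k := by
        intro θ; rw [← Complex.exp_nat_mul]; norm_cast
      refine ⟨⟨fun z => z ^ k, by fun_prop, fun θ => by rw [hval, hk]⟩,
        ⟨fun z => -Complex.I * z ^ k, by fun_prop, fun θ => by rw [hval, hk]; simp⟩⟩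
    -- On the circle a negative power is the conjugate of a positive one, so it has the same real
    -- part and the opposite imaginary part.
    · have hk : ∀ θ : ℝ, Complex.exp (((-(k : ℤ) : ℤ) : ℂ) * (θ * Complex.I)) =
          (starRingEnd ℂ) (Complex.exp (θ * Complex.I) ^ k) := by
        intro θ
        rw [← Complex.exp_nat_mul, ← Complex.exp_conj]
        congr 1
        simp
      refine ⟨⟨fun z => z ^ k, by fun_prop, fun θ => by rw [hval, hk, Complex.conj_re]⟩,
        ⟨fun z => Complex.I * z ^ k, by fun_prop, fun θ => by
          rw [hval, hk, Complex.conj_im]; simp⟩⟩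
  | zero => exact ⟨⟨0, differentiable_const 0, by simp⟩, ⟨0, differentiable_const 0, by simp⟩⟩
  | add x y _ _ hx hy =>
    obtain ⟨⟨q1, d1, h1⟩, ⟨q2, d2, h2⟩⟩ := hx
    obtain ⟨⟨q3, d3, h3⟩, ⟨q4, d4, h4⟩⟩ := hy
    exact ⟨⟨fun z => q1 z + q3 z, d1.add d3, fun θ => by simp [h1, h3]⟩,
      ⟨fun z => q2 z + q4 z, d2.add d4, fun θ => by simp [h2, h4]⟩⟩
  -- Complex scalars mix real and imaginary parts, which is why the induction carries both.
  | smul c x _ hx =>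
    obtain ⟨⟨q1, d1, h1⟩, ⟨q2, d2, h2⟩⟩ := hx
    refine ⟨⟨fun z => (c.re : ℂ) * q1 z - (c.im : ℂ) * q2 z,
      (d1.const_mul _).sub (d2.const_mul _), fun θ => by simp [h1, h2]⟩,
      ⟨fun z => (c.re : ℂ) * q2 z + (c.im : ℂ) * q1 z,
      (d2.const_mul _).add (d1.const_mul _), fun θ => by simp [h1, h2]⟩⟩

/-- Trigonometric polynomials are uniformly dense in the continuous functions on the circle, and
their real parts extend as real parts of entire functions. -/
theorem exists_entire_abs_re_sub_lt {χ : ℂ → ℝ} (hχ : Continuous χ) {η : ℝ} (hη : 0 < η) :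
    ∃ q : ℂ → ℂ, Differentiable ℂ q ∧ ∀ z : ℂ, ‖z‖ = 1 → |(q z).re - χ z| < η := by
  have : Fact (0 < 2 * Real.pi) := ⟨Real.two_pi_pos⟩
  let g : C(AddCircle (2 * Real.pi), ℂ) :=
    ⟨fun x => (χ (AddCircle.toCircle x : ℂ) : ℂ), by
      have : Continuous (AddCircle.toCircle : AddCircle (2 * Real.pi) → Circle) :=
        AddCircle.continuous_toCircle
      fun_prop⟩
  have hg : g ∈ (Submodule.span ℂ (Set.range (@fourier (2 * Real.pi)))).topologicalClosure := by
    rw [span_fourier_closure_eq_top]; trivial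
  obtain ⟨p, hp, hpg⟩ := Metric.mem_closure_iff.1 hg η hη
  obtain ⟨⟨q, hq, hqp⟩, -⟩ := exists_entire_re_eq_and_im_eq_of_mem_span_fourier p hp
  refine ⟨q, hq, fun z hz => ?_⟩
  have hz1 : z = Complex.exp (z.arg * Complex.I) := by
    conv_lhs => rw [← Complex.norm_mul_exp_arg_mul_I z, hz]
    simp
  have h1 : ‖(g - p) ((z.arg : ℝ) : AddCircle (2 * Real.pi))‖ < η :=
    (ContinuousMap.norm_coe_le_norm _ _).trans_lt (by rwa [← dist_eq_norm])
  have h2 : g ((z.arg : ℝ) : AddCircle (2 * Real.pi)) = (χ z : ℂ) := by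
    change (χ (AddCircle.toCircle ((z.arg : ℝ) : AddCircle (2 * Real.pi)) : ℂ) : ℂ) = _
    rw [AddCircle.toCircle_apply_mk, Circle.coe_exp]
    conv_rhs => rw [hz1]
    congr 3
    have : Real.pi ≠ 0 := Real.pi_ne_zero
    field_simp
  have h3 := hqp z.arg
  rw [← hz1] at h3
  rw [h3, abs_sub_comm]
  calc |χ z - (p ((z.arg : ℝ) : AddCircle (2 * Real.pi))).re|
      = |((g - p) ((z.arg : ℝ) : AddCircle (2 * Real.pi))).re| := by
        rw [ContinuousMap.sub_apply, h2]; simp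
    _ ≤ _ := Complex.abs_re_le_norm _
    _ < η := h1

theorem Differentiable.circleAverage_re {q : ℂ → ℂ} (hq : Differentiable ℂ q) :
    Real.circleAverage (fun z => (q z).re) 0 1 = (q 0).re := by
  have h1 : Real.circleAverage q 0 1 = q 0 := hq.diffContOnCl.circleAverage
  have h2 := Complex.reCLM.circleAverage_comp_comm (f := q) (c := 0) (R := 1)
    (hq.continuous.continuousOn.circleIntegrable zero_le_one)
  rw [h1] at h2
  exact h2

/-- A continuous nonnegative function on the circle has an almost optimal majorant that is the
real part of an entire function. -/
theorem exists_entire_re_majorant {χ : ℂ → ℝ} (hχ : Continuous χ) (h0 : ∀ z, 0 ≤ χ z) {η : ℝ}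
    (hη : 0 < η) :
    ∃ q : ℂ → ℂ, Differentiable ℂ q ∧ (∀ z, ‖z‖ ≤ 1 → 0 < (q z).re) ∧
      (∀ z, ‖z‖ = 1 → χ z ≤ (q z).re) ∧ (q 0).im = 0 ∧
      (q 0).re ≤ Real.circleAverage χ 0 1 + η := by
  obtain ⟨p, hp, hpχ⟩ := exists_entire_abs_re_sub_lt hχ (half_pos hη)
  -- The shift by `η / 2` turns the approximation into a majorant; the imaginary constant makes `q
  -- 0` real.
  set q : ℂ → ℂ := fun z => p z + ((η / 2 : ℝ) : ℂ) - ((p 0).im : ℂ) * Complex.I with hq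
  have hdq : Differentiable ℂ q := (hp.add_const _).sub_const _
  have hre : ∀ z, (q z).re = (p z).re + η / 2 := by intro z; simp [hq]
  have hlow : ∀ z, ‖z‖ = 1 → χ z < (q z).re := by
    intro z hz
    rw [hre]; linarith [(abs_lt.1 (hpχ z hz)).1]
  have hup : ∀ z, ‖z‖ = 1 → (q z).re ≤ χ z + η := by
    intro z hz
    rw [hre]; linarith [(abs_lt.1 (hpχ z hz)).2]
  refine ⟨q, hdq, ?_, fun z hz => (hlow z hz).le, by simp [hq], ?_⟩
  · obtain ⟨δ, hδ, hδq⟩ : ∃ δ > 0, ∀ z, ‖z‖ = 1 → δ ≤ (q z).re := by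
      obtain ⟨z0, hz0, hmin⟩ := (isCompact_sphere (0 : ℂ) 1).exists_isMinOn
        (NormedSpace.sphere_nonempty.2 zero_le_one)
        (Complex.continuous_re.comp hdq.continuous).continuousOn
      exact ⟨(q z0).re, (h0 z0).trans_lt (hlow z0 (by simpa using hz0)),
        fun z hz => hmin (by simpa using hz)⟩
    intro z hz
    -- The minimum principle for `Re q`, obtained from the maximum principle for `exp (-q)`.
    have hd : DiffContOnCl ℂ (fun z => Complex.exp (-q z)) (Metric.ball (0 : ℂ) 1) :=
      (Differentiable.cexp hdq.neg).diffContOnCl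
    have h1 := Complex.norm_le_of_forall_mem_frontier_norm_le (C := Real.exp (-δ))
      Metric.isBounded_ball hd (fun w hw => by
        rw [frontier_ball _ one_ne_zero] at hw
        rw [Complex.norm_exp, Complex.neg_re]
        exact Real.exp_le_exp.2 (neg_le_neg (hδq w (by simpa using hw))))
      (z := z) (by rw [closure_ball _ one_ne_zero]; simpa using hz)
    rw [Complex.norm_exp, Complex.neg_re, Real.exp_le_exp] at h1
    linarith
  · rw [← hdq.circleAverage_re, ← Real.circleAverage_const η 0 1]
    have hci : ∀ {g : ℂ → ℝ}, Continuous g → CircleIntegrable g 0 1 := fun hg =>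
      hg.continuousOn.circleIntegrable zero_le_one
    have e : Real.circleAverage χ 0 1 + Real.circleAverage (fun _ => η) 0 1 =
        Real.circleAverage (χ + fun _ => η) 0 1 :=
      (Real.circleAverage_add (hci hχ) (hci continuous_const)).symm
    rw [e]
    refine Real.circleAverage_mono (hci (Complex.continuous_re.comp hdq.continuous))
      (hci (hχ.add continuous_const)) fun z hz => ?_
    exact hup z (by simpa using hz)

/-- Both `g` and `Re r` have the mean value property, so a bound by a harmonic function passes from
the circle to the centre. -/
theorem norm_le_add_mul_re_of_circle_bound {g r : ℂ → ℂ} {M c : ℝ}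
    (hg : DiffContOnCl ℂ g (Metric.ball 0 |1|)) (hr : DiffContOnCl ℂ r (Metric.ball 0 |1|))
    (hbd : ∀ l, ‖l‖ = 1 → ‖g l‖ ≤ M + c * (r l).re) : ‖g 0‖ ≤ M + c * (r 0).re := by
  have hcr : ContinuousOn r (Metric.sphere 0 |1|) := by
    refine hr.continuousOn.mono ?_
    rw [abs_one, closure_ball _ one_ne_zero]
    exact Metric.sphere_subset_closedBall
  have hre : ContinuousOn (fun l => (r l).re) (Metric.sphere 0 |1|) :=
    Complex.continuous_re.comp_continuousOn hcr
  have hmeanr : Real.circleAverage (fun l => (r l).re) 0 1 = (r 0).re := by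
    have h2 := Complex.reCLM.circleAverage_comp_comm (f := r) (c := 0) (R := 1)
      (ContinuousOn.circleIntegrable' hcr)
    rw [hr.circleAverage] at h2
    exact h2
  have hfin : Real.circleAverage (fun l => M + c * (r l).re) 0 1 = M + c * (r 0).re := by
    have hc1 : CircleIntegrable (fun l => c * (r l).re) 0 1 :=
      ContinuousOn.circleIntegrable' (continuousOn_const.mul hre)
    have hc0 : CircleIntegrable (fun _ => M) (0 : ℂ) 1 := circleIntegrable_const _ _ _
    have h1 := Real.circleAverage_add hc0 hc1
    have h2 := Real.circleAverage_fun_smul (a := c) (f := fun l => (r l).re) (c := 0) (R := 1)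
    simp only [smul_eq_mul] at h2
    rw [hmeanr] at h2
    rw [h2, Real.circleAverage_const] at h1
    exact h1
  rw [← hfin, ← hg.circleAverage, Real.circleAverage_def, Real.circleAverage_def, norm_smul,
    smul_eq_mul, Real.norm_of_nonneg (by positivity)]
  gcongr
  refine intervalIntegral.norm_integral_le_of_norm_le Real.two_pi_pos.le ?_ ?_
  · filter_upwards with t _
    exact hbd _ (by simp)
  · exact ContinuousOn.circleIntegrable' (continuousOn_const.add (continuousOn_const.mul hre))

/-! ### The perturbed analytic disc. -/

section
variable {E : Type*} [NormedAddCommGroup E] [InnerProductSpace ℂ E]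

/-- The lower estimate of the height of a point of the perturbed disc. -/
theorem one_sub_norm_disc_ge {Q v : E} (hQ : ‖Q‖ = 1) (hQv : (inner ℂ Q v : ℂ) = 0) (h : ℝ)
    (u l : ℂ) (hl : ‖l‖ ≤ 1) :
    h * u.re - h ^ 2 * ‖u‖ ^ 2 / 2 - ‖v‖ ^ 2 / 2 ≤ 1 - ‖(1 - h * u) • Q + l • v‖ := by
  set z := (1 - h * u) • Q + l • v with hz
  have h1 := norm_add_sq_eq_norm_sq_add_norm_sq_of_inner_eq_zero
    ((1 - h * u) • Q) (l • v) (𝕜 := ℂ) (by rw [inner_smul_left, inner_smul_right, hQv]; simp)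
  rw [← hz, norm_smul, norm_smul, hQ, mul_one] at h1
  have h2 : ‖(1 - h * u : ℂ)‖ * ‖(1 - h * u : ℂ)‖ = 1 - 2 * h * u.re + h ^ 2 * ‖u‖ ^ 2 := by
    rw [Complex.norm_mul_self_eq_normSq, Complex.sq_norm, Complex.normSq_apply,
      Complex.normSq_apply]
    simp
    ring
  have h3 : ‖l‖ * ‖v‖ * (‖l‖ * ‖v‖) ≤ ‖v‖ ^ 2 := by
    have : ‖l‖ ^ 2 ≤ 1 := pow_le_one₀ (norm_nonneg _) hl
    nlinarith [sq_nonneg ‖v‖, mul_le_mul_of_nonneg_right this (sq_nonneg ‖v‖)]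
  nlinarith [sq_nonneg (1 - ‖z‖)]

/-- A vector tangential at `Q` is almost tangential at a nearby `P`: `⟨P, v⟩ = ⟨P - Q, v⟩` and `‖P -
Q‖ ^ 2 ≤ 2 * |1 - ⟨P, Q⟩|`. -/
theorem norm_inner_le_of_inner_eq_zero {P Q v : E} (hP : ‖P‖ = 1) (hQ : ‖Q‖ = 1)
    (hQv : (inner ℂ Q v : ℂ) = 0) :
    ‖(inner ℂ P v : ℂ)‖ ^ 2 ≤ 2 * ‖(1 - inner ℂ P Q : ℂ)‖ * ‖v‖ ^ 2 := by
  have hPP : (inner ℂ P P : ℂ) = 1 := by rw [inner_self_eq_norm_sq_to_K, hP]; simp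
  have hQQ : (inner ℂ Q Q : ℂ) = 1 := by rw [inner_self_eq_norm_sq_to_K, hQ]; simp
  have h1 : (inner ℂ P v : ℂ) = inner ℂ (P - Q) v := by
    rw [inner_sub_left, hQv, sub_zero]
  have h2 : ‖P - Q‖ ^ 2 ≤ 2 * ‖(1 - inner ℂ P Q : ℂ)‖ := by
    rw [@norm_sub_sq ℂ, hP, hQ]
    have := Complex.re_le_norm (1 - inner ℂ P Q : ℂ)
    simp at this ⊢
    linarith
  rw [h1]
  calc ‖(inner ℂ (P - Q) v : ℂ)‖ ^ 2 ≤ (‖P - Q‖ * ‖v‖) ^ 2 := by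
        gcongr; exact norm_inner_le_norm _ _
    _ = ‖P - Q‖ ^ 2 * ‖v‖ ^ 2 := by ring
    _ ≤ _ := by gcongr

/-- The map `w ↦ w / (1 + w)` sends the right half-plane into the disc with diameter `[0, 1]`. It
replaces a possibly large `q` by a bounded function and keeps the real part positive. -/
theorem norm_div_one_add_le {w : ℂ} (hw : 0 < w.re) : ‖w / (1 + w)‖ ≤ 1 := by
  rw [norm_div]
  refine div_le_one_of_le₀ ?_ (norm_nonneg _)
  rw [← sq_le_sq₀ (norm_nonneg _) (norm_nonneg _), Complex.sq_norm, Complex.sq_norm,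
    Complex.normSq_apply, Complex.normSq_apply]
  simp
  nlinarith

/-- The real part is exactly `(Re w + |w| ^ 2) / |1 + w| ^ 2`. -/
theorem re_div_one_add_ge {w : ℂ} (hw : 0 < w.re) :
    ‖w‖ ^ 2 / ‖1 + w‖ ^ 2 ≤ (w / (1 + w)).re := by
  have hpos : 0 < Complex.normSq (1 + w) := Complex.normSq_pos.2 fun h => by
    have := congrArg Complex.re h
    simp at this; linarith
  rw [Complex.div_re, ← add_div, Complex.sq_norm, Complex.sq_norm]
  gcongr
  rw [Complex.normSq_apply]
  simp
  nlinarith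

theorem one_fourth_le_re_div_one_add {w : ℂ} (hw : 0 < w.re) (hw1 : 1 ≤ ‖w‖) :
    1 / 4 ≤ (w / (1 + w)).re := by
  refine le_trans ?_ (re_div_one_add_ge hw)
  have h1 : ‖1 + w‖ ≤ 2 * ‖w‖ := by
    refine (norm_add_le _ _).trans ?_
    rw [norm_one]; linarith
  have h0 : 0 < ‖1 + w‖ := norm_pos_iff.2 fun h => by
    have := congrArg Complex.re h
    simp at this; linarith
  rw [div_le_div_iff₀ (by norm_num) (by positivity)]
  nlinarith

/-- One step of the disc argument: an analytic disc through `(1 - h) • Q` whose boundary lies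
partly in the union of the Stolz regions over `F` and partly in the Korányi region at `P`. -/
theorem norm_le_of_disc {f : E → ℂ} (hf : DifferentiableOn ℂ f (Metric.ball 0 1))
    {P Q v : E} (hP : ‖P‖ = 1) (hQ : ‖Q‖ = 1) (hQv : (inner ℂ Q v : ℂ) = 0)
    {F : Set E} {α γ h M D a : ℝ} (hD0 : 0 ≤ D)
    (hγ : 0 < γ) (hγ1 : γ ≤ 1 / 10) (hγα : 20 * γ ≤ α - 1)
    (hh : 0 < h) (hhγ : h ≤ γ / 1000) (hv : ‖v‖ ^ 2 ≤ γ ^ 2 / 1000 * h)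
    (hPQ : ‖(1 - inner ℂ P ((1 - h : ℂ) • Q) : ℂ)‖ < 16 * h)
    (hM : ∀ z : E, ‖z‖ < 1 → (∃ R ∈ F, ‖z - R‖ < α * (1 - ‖z‖)) → ‖f z‖ ≤ M)
    (hD : ∀ z : E, ‖z‖ < 1 → ‖(1 - inner ℂ P z : ℂ)‖ < 16 * (1 - ‖z‖) → h ≤ 1 - ‖z‖ →
      ‖f z‖ ≤ M + D)
    {q : ℂ → ℂ} (hq : Differentiable ℂ q) (hq0 : q 0 = a) (ha0 : 0 < a) (ha : a ≤ 1 / 100)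
    (hqpos : ∀ l, ‖l‖ ≤ 1 → 0 < (q l).re)
    (hqF : ∀ l, ‖l‖ = 1 → ‖q l‖ < 1 → ∃ R ∈ F, ‖R - (Q + l • v)‖ ≤ γ * h) :
    ‖f ((1 - h : ℂ) • Q)‖ ≤ M + D / 2 := by
  set r : ℂ → ℂ := fun l => q l / (1 + q l) with hr
  set b : ℝ := a / (1 + a) with hb
  have hb0 : 0 < b := by positivity
  have hba : b ≤ 1 / 100 := by
    refine le_trans ?_ ha
    rw [hb]; exact div_le_self ha0.le (by linarith)
  have hr0 : r 0 = b := by simp [hr, hq0, hb]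
  have hne : ∀ l, ‖l‖ ≤ 1 → 1 + q l ≠ 0 := fun l hl h0 => by
    have := congrArg Complex.re h0
    have := hqpos l hl
    simp at *; linarith
  have hr1 : ∀ l, ‖l‖ ≤ 1 → ‖r l‖ ≤ 1 := fun l hl => norm_div_one_add_le (hqpos l hl)
  have hrre : ∀ l, ‖l‖ ≤ 1 → 0 ≤ (r l).re := fun l hl =>
    le_trans (by positivity) (re_div_one_add_ge (hqpos l hl))
  -- Subtracting `b = r 0` gives `m 0 = 0`, so the disc is centred at `(1 - h) • Q`; its height is
  -- `h * (1 + Re m)` up to `0.002 * γ * h`.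
  set m : ℂ → ℂ := fun l => γ * (r l - b) with hm
  have hm1 : ∀ l, ‖l‖ ≤ 1 → ‖m l‖ ≤ 1.01 * γ := by
    intro l hl
    rw [hm, norm_mul, Complex.norm_real, Real.norm_eq_abs, abs_of_pos hγ, mul_comm]
    gcongr
    refine (norm_sub_le _ _).trans ?_
    rw [Complex.norm_real, Real.norm_eq_abs, abs_of_pos hb0]
    linarith [hr1 l hl]
  have hmre : ∀ l, (m l).re = γ * ((r l).re - b) := by intro l; simp [hm]
  set φ : ℂ → E := fun l => (1 - h * (1 + m l)) • Q + l • v with hφ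
  have hu1 : ∀ l, ‖l‖ ≤ 1 → ‖1 + m l‖ ≤ 1 + 1.01 * γ := by
    intro l hl
    refine (norm_add_le _ _).trans ?_
    rw [norm_one]; linarith [hm1 l hl]
  have hheight : ∀ l, ‖l‖ ≤ 1 → h * (1 + (m l).re - 0.002 * γ) ≤ 1 - ‖φ l‖ := by
    intro l hl
    refine le_trans ?_ (one_sub_norm_disc_ge hQ hQv h (1 + m l) l hl)
    have h1 : ‖1 + m l‖ ^ 2 ≤ 2 := by
      have := hu1 l hl
      nlinarith [norm_nonneg (1 + m l)]
    have h2 : h ^ 2 * ‖1 + m l‖ ^ 2 ≤ h * (γ / 1000) * 2 := by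
      rw [pow_two]; gcongr
    have h3 : γ ^ 2 / 1000 * h ≤ γ * h / 1000 := by nlinarith [mul_pos hγ hh]
    have h4 : (1 + m l).re = 1 + (m l).re := by simp
    rw [h4]
    nlinarith [mul_pos hγ hh]
  have hball : ∀ l, ‖l‖ ≤ 1 → ‖φ l‖ < 1 := by
    intro l hl
    have h1 := hheight l hl
    have h2 : 0 < h * (1 + (m l).re - 0.002 * γ) := by
      refine mul_pos hh ?_
      rw [hmre]
      nlinarith [hrre l hl, mul_nonneg hγ.le (hrre l hl)]
    linarith
  have hrd : ∀ l, ‖l‖ ≤ 1 → DifferentiableAt ℂ r l := fun l hl =>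
    (hq l).fun_div ((hq l).const_add 1) (hne l hl)
  have hrdc : DiffContOnCl ℂ r (Metric.ball 0 |1|) := by
    refine DifferentiableOn.diffContOnCl fun l hl => ?_
    rw [abs_one, closure_ball _ one_ne_zero] at hl
    exact (hrd l (by simpa using hl)).differentiableWithinAt
  have hgdc : DiffContOnCl ℂ (fun l => f (φ l)) (Metric.ball 0 |1|) := by
    refine DifferentiableOn.diffContOnCl fun l hl => ?_
    rw [abs_one, closure_ball _ one_ne_zero] at hl
    have hl1 : ‖l‖ ≤ 1 := by simpa using hl
    have h1 : DifferentiableAt ℂ φ l := by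
      have : DifferentiableAt ℂ m l := ((hrd l hl1).sub_const _).const_mul _
      exact ((((this.const_add 1).const_mul _).const_sub 1).smul_const Q).add
        (differentiableAt_id.smul_const v)
    have h2 : DifferentiableAt ℂ f (φ l) :=
      hf.differentiableAt (Metric.isOpen_ball.mem_nhds (by simpa using hball l hl1))
    exact (h2.comp l h1).differentiableWithinAt
  have hbd : ∀ l, ‖l‖ = 1 → ‖f (φ l)‖ ≤ M + 4 * D * (r l).re := by
    intro l hl
    -- If `‖q l‖ < 1`, the circle is near `F` and the disc drops by at most `0.012 * γ * h`, so it
    -- lies in a Stolz region. Otherwise `Re r ≥ 1 / 4`, and `4 * D * Re r` pays for `D`.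
    by_cases hql : ‖q l‖ < 1
    · have h0 : 0 ≤ 4 * D * (r l).re := mul_nonneg (by linarith) (hrre l hl.le)
      refine le_trans (hM _ (hball l hl.le) ?_) (by linarith)
      obtain ⟨R, hR, hRl⟩ := hqF l hl hql
      refine ⟨R, hR, ?_⟩
      have h1 : ‖φ l - R‖ ≤ h * ‖1 + m l‖ + γ * h := by
        have : φ l - R = -((h * (1 + m l)) • Q) - (R - (Q + l • v)) := by
          simp only [hφ, sub_smul, one_smul]; abel
        rw [this]
        refine (norm_sub_le _ _).trans (add_le_add (le_of_eq ?_) hRl)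
        rw [norm_neg, norm_smul, norm_mul, hQ, mul_one, Complex.norm_real, Real.norm_eq_abs,
          abs_of_pos hh]
      have h2 := hheight l hl.le
      have h3 : -(0.01 * γ) ≤ (m l).re := by
        rw [hmre]; nlinarith [mul_nonneg hγ.le (hrre l hl.le)]
      have h4 : h * (1 - 0.012 * γ) ≤ 1 - ‖φ l‖ := by
        exact le_trans (mul_le_mul_of_nonneg_left (by linarith) hh.le) h2
      calc ‖φ l - R‖ ≤ h * (1 + 1.01 * γ) + γ * h := by
            refine h1.trans ?_
            gcongr; exact hu1 l hl.le
        _ < (1 + 20 * γ) * (h * (1 - 0.012 * γ)) := by nlinarith [mul_pos hγ hh]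
        _ ≤ α * (1 - ‖φ l‖) := by
            have h5 : 1 + 20 * γ ≤ α := by linarith
            have h6 : 0 ≤ h * (1 - 0.012 * γ) := mul_nonneg hh.le (by linarith)
            gcongr
            linarith
    · have h1 := one_fourth_le_re_div_one_add (hqpos l hl.le) (not_lt.1 hql)
      change 1 / 4 ≤ (r l).re at h1
      refine le_trans (hD _ (hball l hl.le) ?_ ?_) (by nlinarith)
      -- The push raises the height by `0.238 * γ * h`, hence the right side of the Korányi
      -- condition by about `3.8 * γ * h`, while `|1 - ⟨P, φ l⟩|` grows by at most `1.2 * γ * h`.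
      -- The large aperture 16 makes the region stable.
      · have h2 := hheight l hl.le
        have h3 : 0.24 * γ ≤ (m l).re := by rw [hmre]; nlinarith
        have h4 : h * (1 + 0.238 * γ) ≤ 1 - ‖φ l‖ := by
          exact le_trans (mul_le_mul_of_nonneg_left (by linarith) hh.le) h2
        have h5 : (1 - inner ℂ P (φ l) : ℂ) = (1 - inner ℂ P ((1 - h : ℂ) • Q)) +
            h * m l * inner ℂ P Q - l * inner ℂ P v := by
          simp only [hφ, inner_add_right, inner_smul_right]; ring
        have h6 : ‖(1 - inner ℂ P Q : ℂ)‖ ≤ 17 * h := by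
          have : (1 - inner ℂ P Q : ℂ) = (1 - inner ℂ P ((1 - h : ℂ) • Q)) -
              h * inner ℂ P Q := by
            rw [inner_smul_right]; ring
          rw [this]
          refine (norm_sub_le _ _).trans ?_
          have h7 : ‖(h * inner ℂ P Q : ℂ)‖ ≤ h * 1 := by
            rw [norm_mul, Complex.norm_real, Real.norm_eq_abs, abs_of_pos hh]
            gcongr
            simpa [hP, hQ] using norm_inner_le_norm (𝕜 := ℂ) P Q
          linarith
        have h7 : ‖(inner ℂ P v : ℂ)‖ ≤ 0.19 * γ * h := by
          refine abs_le_of_sq_le_sq' ?_ (by positivity) |>.2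
          refine (norm_inner_le_of_inner_eq_zero hP hQ hQv).trans ?_
          calc 2 * ‖(1 - inner ℂ P Q : ℂ)‖ * ‖v‖ ^ 2
              ≤ 2 * (17 * h) * (γ ^ 2 / 1000 * h) := by gcongr
            _ ≤ (0.19 * γ * h) ^ 2 := by nlinarith [sq_nonneg (γ * h)]
        have h8 : ‖(h * m l * inner ℂ P Q : ℂ)‖ ≤ h * (1.01 * γ) * 1 := by
          rw [norm_mul, norm_mul, Complex.norm_real, Real.norm_eq_abs, abs_of_pos hh]
          gcongr
          · exact hm1 l hl.le
          · simpa [hP, hQ] using norm_inner_le_norm (𝕜 := ℂ) P Q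
        have h9 : ‖(l * inner ℂ P v : ℂ)‖ ≤ 0.19 * γ * h := by rwa [norm_mul, hl, one_mul]
        rw [h5]
        have h10 := norm_sub_le ((1 - inner ℂ P ((1 - h : ℂ) • Q)) +
            h * m l * inner ℂ P Q : ℂ) (l * inner ℂ P v)
        have h11 := norm_add_le (1 - inner ℂ P ((1 - h : ℂ) • Q) : ℂ) (h * m l * inner ℂ P Q)
        linarith [mul_pos hγ hh]
      · refine le_trans ?_ (hheight l hl.le)
        rw [hmre]
        nlinarith [mul_pos hγ hh]
  have hz0 : φ 0 = (1 - h : ℂ) • Q := by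
    simp [hφ, hm, hr0]
  have hfin := norm_le_add_mul_re_of_circle_bound hgdc hrdc hbd
  rw [hz0, hr0, Complex.ofReal_re] at hfin
  -- Here `4 * b ≤ 1 / 25`, well below `1 / 2`.
  nlinarith
end

/-! ### The hemisphere as a graph over its tangent space. -/

section
variable {k : ℕ}

/-- An isometric parametrization of the complex orthogonal complement of a unit vector. -/
theorem exists_linearIsometry_orthogonal {Q : EuclideanSpace ℂ (Fin (k + 1))} (hQ : ‖Q‖ = 1) :
    ∃ ι : EuclideanSpace ℂ (Fin k) →ₗᵢ[ℂ] EuclideanSpace ℂ (Fin (k + 1)),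
      (∀ w, (inner ℂ Q (ι w) : ℂ) = 0) ∧ ∀ x, (inner ℂ Q x : ℂ) = 0 → ∃ w, ι w = x := by
  have : Fact (Module.finrank ℂ (EuclideanSpace ℂ (Fin (k + 1))) = k + 1) :=
    ⟨finrank_euclideanSpace_fin⟩
  have hQ0 : Q ≠ 0 := by rintro rfl; simp at hQ
  let b := OrthonormalBasis.fromOrthogonalSpanSingleton (𝕜 := ℂ) k hQ0
  refine ⟨(Submodule.subtypeₗᵢ _).comp b.repr.symm.toLinearIsometry, fun w => ?_, fun x hx => ?_⟩
  · exact Submodule.mem_orthogonal_singleton_iff_inner_right.1 (b.repr.symm w).2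
  · refine ⟨b.repr ⟨x, Submodule.mem_orthogonal_singleton_iff_inner_right.2 hx⟩, ?_⟩
    simp

/-- The parametrization of a hemisphere as a graph over its tangent space. -/
noncomputable def sphereGraph (Q : EuclideanSpace ℂ (Fin (k + 1)))
    (ι : EuclideanSpace ℂ (Fin k) →ₗᵢ[ℂ] EuclideanSpace ℂ (Fin (k + 1)))
    (p : EuclideanSpace ℂ (Fin k) × ℝ) : EuclideanSpace ℂ (Fin (k + 1)) :=
  ((Real.sqrt (1 - ‖p.1‖ ^ 2 - p.2 ^ 2) : ℂ) + p.2 * Complex.I) • Q + ι p.1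

variable {Q : EuclideanSpace ℂ (Fin (k + 1))}
  {ι : EuclideanSpace ℂ (Fin k) →ₗᵢ[ℂ] EuclideanSpace ℂ (Fin (k + 1))}

theorem norm_sq_smul_add (hQ : ‖Q‖ = 1) (hι : ∀ w, (inner ℂ Q (ι w) : ℂ) = 0) (c : ℂ)
    (w : EuclideanSpace ℂ (Fin k)) : ‖c • Q + ι w‖ ^ 2 = ‖c‖ ^ 2 + ‖w‖ ^ 2 := by
  have h1 := norm_add_sq_eq_norm_sq_add_norm_sq_of_inner_eq_zero
    (c • Q) (ι w) (𝕜 := ℂ) (by rw [inner_smul_left, hι]; simp)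
  rw [norm_smul, hQ, mul_one, ι.norm_map] at h1
  rw [pow_two, h1]; ring

theorem inner_smul_add (hQ : ‖Q‖ = 1) (hι : ∀ w, (inner ℂ Q (ι w) : ℂ) = 0) (c : ℂ)
    (w : EuclideanSpace ℂ (Fin k)) : (inner ℂ Q (c • Q + ι w) : ℂ) = c := by
  rw [inner_add_right, inner_smul_right, hι, inner_self_eq_norm_sq_to_K, hQ]; simp

theorem norm_sphereGraph (hQ : ‖Q‖ = 1) (hι : ∀ w, (inner ℂ Q (ι w) : ℂ) = 0)
    {p : EuclideanSpace ℂ (Fin k) × ℝ} (hp : ‖p.1‖ ^ 2 + p.2 ^ 2 ≤ 1) :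
    ‖sphereGraph Q ι p‖ = 1 := by
  have h1 := norm_sq_smul_add hQ hι
    ((Real.sqrt (1 - ‖p.1‖ ^ 2 - p.2 ^ 2) : ℂ) + p.2 * Complex.I) p.1
  have h2 : ‖((Real.sqrt (1 - ‖p.1‖ ^ 2 - p.2 ^ 2) : ℂ) + p.2 * Complex.I)‖ ^ 2 =
      1 - ‖p.1‖ ^ 2 - p.2 ^ 2 + p.2 ^ 2 := by
    rw [Complex.sq_norm, Complex.normSq_add_mul_I, Real.sq_sqrt (by linarith)]
  rw [h2] at h1
  have h3 : ‖sphereGraph Q ι p‖ ^ 2 = 1 := by rw [sphereGraph, h1]; ring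
  exact (pow_eq_one_iff_of_nonneg (norm_nonneg _) two_ne_zero).1 h3

/-- The parameters are recovered by orthogonal projection, which does not increase distances. This
gives lower bounds for surface measure. -/
theorem antilipschitzWith_sphereGraph (hQ : ‖Q‖ = 1) (hι : ∀ w, (inner ℂ Q (ι w) : ℂ) = 0) :
    AntilipschitzWith 1 (sphereGraph Q ι) := by
  refine AntilipschitzWith.of_le_mul_dist fun p p' => ?_
  rw [NNReal.coe_one, one_mul, dist_eq_norm (sphereGraph Q ι p)]
  set c : ℂ := ((Real.sqrt (1 - ‖p.1‖ ^ 2 - p.2 ^ 2) : ℂ) + p.2 * Complex.I) -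
    ((Real.sqrt (1 - ‖p'.1‖ ^ 2 - p'.2 ^ 2) : ℂ) + p'.2 * Complex.I) with hc
  have h1 : sphereGraph Q ι p - sphereGraph Q ι p' = c • Q + ι (p.1 - p'.1) := by
    rw [hc, sub_smul, map_sub, sphereGraph, sphereGraph]; abel
  have h2 := norm_sq_smul_add hQ hι c (p.1 - p'.1)
  rw [← h1] at h2
  have h3 : p.2 - p'.2 = c.im := by simp [hc]
  refine max_le ?_ ?_
  · rw [dist_eq_norm]
    exact abs_le_of_sq_le_sq' (by nlinarith [sq_nonneg ‖c‖]) (norm_nonneg _) |>.2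
  · rw [Real.dist_eq, h3]
    refine (Complex.abs_im_le_norm c).trans ?_
    exact abs_le_of_sq_le_sq' (by nlinarith [sq_nonneg ‖p.1 - p'.1‖]) (norm_nonneg _) |>.2

/-- The square root is at least `1 / 2` here, so a difference of squares controls its variation by
four times the distance; the two linear parts add one each. -/
theorem lipschitzOnWith_sphereGraph (hQ : ‖Q‖ = 1) :
    LipschitzOnWith 6 (sphereGraph Q ι) {p | ‖p.1‖ ^ 2 + p.2 ^ 2 ≤ 1 / 2} := by
  refine LipschitzOnWith.of_dist_le_mul fun p hp p' hp' => ?_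
  simp only [Set.mem_ofPred_eq] at hp hp'
  rw [dist_eq_norm (sphereGraph Q ι p)]
  set a := Real.sqrt (1 - ‖p.1‖ ^ 2 - p.2 ^ 2) with ha
  set a' := Real.sqrt (1 - ‖p'.1‖ ^ 2 - p'.2 ^ 2) with ha'
  have e1 : a ^ 2 = 1 - ‖p.1‖ ^ 2 - p.2 ^ 2 := Real.sq_sqrt (by linarith)
  have e2 : a' ^ 2 = 1 - ‖p'.1‖ ^ 2 - p'.2 ^ 2 := Real.sq_sqrt (by linarith)
  have g1 : 1 / 2 ≤ a := Real.le_sqrt_of_sq_le (by linarith)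
  have g2 : 1 / 2 ≤ a' := Real.le_sqrt_of_sq_le (by linarith)
  set D := dist p p' with hD
  have d1 : ‖p.1 - p'.1‖ ≤ D := by rw [← dist_eq_norm]; exact le_max_left _ _
  have d2 : |p.2 - p'.2| ≤ D := by rw [← Real.dist_eq]; exact le_max_right _ _
  have h1 : sphereGraph Q ι p - sphereGraph Q ι p' =
      (((a - a' : ℝ) : ℂ) + ((p.2 - p'.2 : ℝ) : ℂ) * Complex.I) • Q + ι (p.1 - p'.1) := by
    rw [map_sub, sphereGraph, sphereGraph, ← ha, ← ha']
    push_cast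
    module
  have h2 : |a - a'| ≤ 4 * D := by
    have n1 : |‖p.1‖ - ‖p'.1‖| ≤ D := (abs_norm_sub_norm_le _ _).trans d1
    have n2 : ‖p.1‖ ≤ 1 := by nlinarith [norm_nonneg p.1]
    have n3 : ‖p'.1‖ ≤ 1 := by nlinarith [norm_nonneg p'.1]
    have n4 : |p.2| ≤ 1 := abs_le_of_sq_le_sq (by nlinarith [sq_nonneg ‖p.1‖]) zero_le_one
    have n5 : |p'.2| ≤ 1 := abs_le_of_sq_le_sq (by nlinarith [sq_nonneg ‖p'.1‖]) zero_le_one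
    have e3 : (a - a') * (a + a') = -((‖p.1‖ - ‖p'.1‖) * (‖p.1‖ + ‖p'.1‖)) -
        (p.2 - p'.2) * (p.2 + p'.2) := by nlinarith
    have e4 : |a - a'| * (a + a') ≤ 2 * D + 2 * D := by
      calc |a - a'| * (a + a') = |(a - a') * (a + a')| := by
            rw [abs_mul, abs_of_pos (by linarith : 0 < a + a')]
        _ ≤ |(‖p.1‖ - ‖p'.1‖) * (‖p.1‖ + ‖p'.1‖)| + |(p.2 - p'.2) * (p.2 + p'.2)| := by
            rw [e3]
            refine (abs_sub _ _).trans ?_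
            rw [abs_neg]
        _ ≤ D * 2 + D * 2 := by
            rw [abs_mul, abs_mul]
            have m1 : |‖p.1‖ + ‖p'.1‖| ≤ 2 := by
              rw [abs_of_nonneg (by positivity)]; linarith
            have m2 : |p.2 + p'.2| ≤ 2 := (abs_add_le _ _).trans (by linarith)
            have hD0 : 0 ≤ D := dist_nonneg
            gcongr
        _ = _ := by ring
    nlinarith [abs_nonneg (a - a')]
  rw [h1]
  have h3 := norm_add_le ((((a - a' : ℝ) : ℂ) + ((p.2 - p'.2 : ℝ) : ℂ) * Complex.I) • Q)
    (ι (p.1 - p'.1))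
  have h4 := norm_add_le ((a - a' : ℝ) : ℂ) (((p.2 - p'.2 : ℝ) : ℂ) * Complex.I)
  rw [norm_smul, hQ, mul_one, ι.norm_map] at h3
  rw [norm_mul, Complex.norm_I, mul_one, Complex.norm_real, Complex.norm_real, Real.norm_eq_abs,
    Real.norm_eq_abs] at h4
  push_cast at *
  linarith

/-- The root `a` satisfies `1 - a ≤ 1 - a ^ 2`. Hence a nonisotropic ball of radius `r` contains
tangential displacements of order `r`, but only order `r ^ 2` in the direction `I • Q`. -/
theorem norm_one_sub_inner_sphereGraph_le (hQ : ‖Q‖ = 1) (hι : ∀ w, (inner ℂ Q (ι w) : ℂ) = 0)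
    {p : EuclideanSpace ℂ (Fin k) × ℝ} (hp : ‖p.1‖ ^ 2 + p.2 ^ 2 ≤ 1) :
    ‖(1 - inner ℂ Q (sphereGraph Q ι p) : ℂ)‖ ≤ ‖p.1‖ ^ 2 + p.2 ^ 2 + |p.2| := by
  rw [sphereGraph, inner_smul_add hQ hι]
  set a := Real.sqrt (1 - ‖p.1‖ ^ 2 - p.2 ^ 2) with ha
  have e1 : a ^ 2 = 1 - ‖p.1‖ ^ 2 - p.2 ^ 2 := Real.sq_sqrt (by linarith)
  have e0 : 0 ≤ a := Real.sqrt_nonneg _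
  have e2 : a ≤ 1 := by nlinarith [sq_nonneg ‖p.1‖, sq_nonneg p.2]
  have h : (1 - ((a : ℂ) + p.2 * Complex.I) : ℂ) = ((1 - a : ℝ) : ℂ) - p.2 * Complex.I := by
    push_cast; ring
  rw [h]
  refine (norm_sub_le _ _).trans ?_
  rw [norm_mul, Complex.norm_I, mul_one, Complex.norm_real, Complex.norm_real, Real.norm_eq_abs,
    Real.norm_eq_abs, abs_of_nonneg (by linarith)]
  nlinarith

theorem norm_sphereGraph_sub_le (hQ : ‖Q‖ = 1)
    {p : EuclideanSpace ℂ (Fin k) × ℝ} (hp : ‖p.1‖ ^ 2 + p.2 ^ 2 ≤ 1) :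
    ‖sphereGraph Q ι p - (Q + ι p.1)‖ ≤ ‖p.1‖ ^ 2 + p.2 ^ 2 + |p.2| := by
  rw [sphereGraph]
  set a := Real.sqrt (1 - ‖p.1‖ ^ 2 - p.2 ^ 2) with ha
  have e1 : a ^ 2 = 1 - ‖p.1‖ ^ 2 - p.2 ^ 2 := Real.sq_sqrt (by linarith)
  have e0 : 0 ≤ a := Real.sqrt_nonneg _
  have e2 : a ≤ 1 := by nlinarith [sq_nonneg ‖p.1‖, sq_nonneg p.2]
  have h : ((a : ℂ) + p.2 * Complex.I) • Q + ι p.1 - (Q + ι p.1) =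
      (p.2 * Complex.I - ((1 - a : ℝ) : ℂ)) • Q := by
    push_cast; module
  rw [h, norm_smul, hQ, mul_one]
  refine (norm_sub_le _ _).trans ?_
  rw [norm_mul, Complex.norm_I, mul_one, Complex.norm_real, Complex.norm_real, Real.norm_eq_abs,
    Real.norm_eq_abs, abs_of_nonneg (by linarith : 0 ≤ 1 - a)]
  nlinarith

/-- Since `r ≤ 1`, the coordinate `Re ⟨Q, x⟩` is nonnegative and equals the positive square root in
the graph. -/
theorem exists_sphereGraph_eq (hQ : ‖Q‖ = 1)
    (hι' : ∀ x, (inner ℂ Q x : ℂ) = 0 → ∃ w, ι w = x) (hι : ∀ w, (inner ℂ Q (ι w) : ℂ) = 0)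
    {x : EuclideanSpace ℂ (Fin (k + 1))} (hx : ‖x‖ = 1)
    {r : ℝ} (hr : r ≤ 1) (hxr : ‖(1 - inner ℂ Q x : ℂ)‖ ≤ r) :
    ∃ p : EuclideanSpace ℂ (Fin k) × ℝ, ‖p.1‖ ^ 2 ≤ 2 * r ∧ |p.2| ≤ r ∧
      sphereGraph Q ι p = x := by
  set c : ℂ := inner ℂ Q x with hc
  obtain ⟨w, hw⟩ := hι' (x - c • Q) (by
    rw [inner_sub_right, inner_smul_right, inner_self_eq_norm_sq_to_K, hQ, ← hc]; simp)
  have hx' : x = c • Q + ι w := by rw [hw]; abel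
  have h1 := norm_sq_smul_add hQ hι c w
  rw [← hx', hx] at h1
  have hre : 1 - c.re ≤ r := by
    have := Complex.re_le_norm (1 - c)
    simp at this; linarith
  have him : |c.im| ≤ r := by
    have := Complex.abs_im_le_norm (1 - c)
    simp at this; linarith
  have hcn : ‖c‖ ^ 2 = c.re ^ 2 + c.im ^ 2 := by
    rw [Complex.sq_norm, Complex.normSq_apply]; ring
  refine ⟨(w, c.im), ?_, him, ?_⟩
  · simp only
    nlinarith [sq_nonneg (1 - c.re), sq_nonneg c.im]
  · rw [sphereGraph]
    have h2 : 1 - ‖w‖ ^ 2 - c.im ^ 2 = c.re ^ 2 := by linarith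
    rw [hx']
    simp only
    rw [h2, Real.sqrt_sq (by linarith), Complex.re_add_im]

end

/-! ### The sphere with the Korányi metric -/

/-- The unit sphere of `ℂ^(k+1)`, to be endowed with the metric `|1 - z · w̄|^(1/2)`. -/
def KoranyiSphere (k : ℕ) : Type := {x : EuclideanSpace ℂ (Fin (k + 1)) // ‖x‖ = 1}

namespace KoranyiSphere

variable {k : ℕ}

/-- The point of the ambient space. -/
def val (x : KoranyiSphere k) : EuclideanSpace ℂ (Fin (k + 1)) := Subtype.val x

/-- A unit vector as a point of the sphere. -/
def ofNorm (x : EuclideanSpace ℂ (Fin (k + 1))) (hx : ‖x‖ = 1) : KoranyiSphere k := ⟨x, hx⟩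

theorem val_ofNorm (x : EuclideanSpace ℂ (Fin (k + 1))) (hx : ‖x‖ = 1) : (ofNorm x hx).val = x :=
  rfl

theorem norm_val (x : KoranyiSphere k) : ‖x.val‖ = 1 := Subtype.property x

theorem val_injective : Function.Injective (val : KoranyiSphere k → _) := Subtype.val_injective

theorem inner_val_self (x : KoranyiSphere k) : (inner ℂ x.val x.val : ℂ) = 1 := by
  rw [inner_self_eq_norm_sq_to_K, x.norm_val]; simp

theorem norm_one_sub_inner_comm (x y : EuclideanSpace ℂ (Fin (k + 1))) :
    ‖(1 - inner ℂ x y : ℂ)‖ = ‖(1 - inner ℂ y x : ℂ)‖ := by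
  rw [← inner_conj_symm y x, ← RCLike.norm_conj (1 - inner ℂ x y), map_sub, map_one]

theorem norm_val_sub_sq_le (x y : KoranyiSphere k) :
    ‖x.val - y.val‖ ^ 2 ≤ 2 * ‖(1 - inner ℂ x.val y.val : ℂ)‖ := by
  rw [@norm_sub_sq ℂ, x.norm_val, y.norm_val]
  have := Complex.re_le_norm (1 - inner ℂ x.val y.val : ℂ)
  simp at this ⊢
  linarith

/-- Split `x` and `z` along `y`. The orthogonal parts have norms at most `√2 * a` and `√2 * b`, so
`|1 - ⟨x, z⟩| ≤ a ^ 2 + b ^ 2 + 2 * a * b`. -/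
theorem sqrt_norm_one_sub_inner_le (x y z : KoranyiSphere k) :
    Real.sqrt ‖(1 - inner ℂ x.val z.val : ℂ)‖ ≤
      Real.sqrt ‖(1 - inner ℂ x.val y.val : ℂ)‖ + Real.sqrt ‖(1 - inner ℂ y.val z.val : ℂ)‖ := by
  set a := Real.sqrt ‖(1 - inner ℂ x.val y.val : ℂ)‖ with ha
  set b := Real.sqrt ‖(1 - inner ℂ y.val z.val : ℂ)‖ with hb
  have ha2 : a ^ 2 = ‖(1 - inner ℂ x.val y.val : ℂ)‖ := Real.sq_sqrt (norm_nonneg _)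
  have hb2 : b ^ 2 = ‖(1 - inner ℂ y.val z.val : ℂ)‖ := Real.sq_sqrt (norm_nonneg _)
  have ha0 : 0 ≤ a := Real.sqrt_nonneg _
  have hb0 : 0 ≤ b := Real.sqrt_nonneg _
  refine Real.sqrt_le_iff.2 ⟨by positivity, ?_⟩
  have e : ∀ v : KoranyiSphere k,
      ‖v.val - (inner ℂ y.val v.val : ℂ) • y.val‖ ^ 2 ≤ 2 * ‖(1 - inner ℂ y.val v.val : ℂ)‖ := by
    intro v
    have h1 : ‖v.val - (inner ℂ y.val v.val : ℂ) • y.val‖ ^ 2 =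
        1 - ‖(inner ℂ y.val v.val : ℂ)‖ ^ 2 := by
      have h2 := norm_add_sq_eq_norm_sq_add_norm_sq_of_inner_eq_zero
        (v.val - (inner ℂ y.val v.val : ℂ) • y.val) ((inner ℂ y.val v.val : ℂ) • y.val) (𝕜 := ℂ)
        (by
          rw [inner_smul_right, inner_sub_left, inner_smul_left, y.inner_val_self,
            inner_conj_symm, mul_one, sub_self, mul_zero])
      rw [sub_add_cancel, norm_smul, v.norm_val, y.norm_val] at h2
      nlinarith
    have h3 := norm_sub_norm_le (1 : ℂ) (inner ℂ y.val v.val)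
    have h4 : ‖(inner ℂ y.val v.val : ℂ)‖ ≤ 1 := by
      simpa [y.norm_val, v.norm_val] using norm_inner_le_norm (𝕜 := ℂ) y.val v.val
    rw [norm_one] at h3
    rw [h1]
    nlinarith [norm_nonneg (inner ℂ y.val v.val : ℂ)]
  have hx := e x
  have hz := e z
  rw [norm_one_sub_inner_comm, ← ha2] at hx
  rw [← hb2] at hz
  set x' := x.val - (inner ℂ y.val x.val : ℂ) • y.val with hx'
  set z' := z.val - (inner ℂ y.val z.val : ℂ) • y.val with hz'
  have key : (1 - inner ℂ x.val z.val : ℂ) = (1 - inner ℂ x.val y.val) +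
      inner ℂ x.val y.val * (1 - inner ℂ y.val z.val) - inner ℂ x' z' := by
    rw [hx', hz']
    simp only [inner_sub_left, inner_sub_right, inner_smul_left, inner_smul_right,
      y.inner_val_self, inner_conj_symm]
    ring
  have h5 : ‖(inner ℂ x.val y.val : ℂ)‖ ≤ 1 := by
    simpa [y.norm_val, x.norm_val] using norm_inner_le_norm (𝕜 := ℂ) x.val y.val
  have h6 : ‖(inner ℂ x' z' : ℂ)‖ ≤ 2 * a * b := by
    refine (norm_inner_le_norm _ _).trans ?_
    refine abs_le_of_sq_le_sq' ?_ (by positivity) |>.2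
    rw [mul_pow]
    calc ‖x'‖ ^ 2 * ‖z'‖ ^ 2 ≤ (2 * a ^ 2) * (2 * b ^ 2) := by gcongr
      _ = _ := by ring
  have h7 : ‖(inner ℂ x.val y.val * (1 - inner ℂ y.val z.val) : ℂ)‖ ≤ b ^ 2 := by
    rw [norm_mul, ← hb2]
    exact mul_le_of_le_one_left (sq_nonneg _) h5
  rw [key]
  have h8 := norm_sub_le ((1 - inner ℂ x.val y.val) +
      inner ℂ x.val y.val * (1 - inner ℂ y.val z.val) : ℂ) (inner ℂ x' z')
  have h9 := norm_add_le (1 - inner ℂ x.val y.val : ℂ)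
    (inner ℂ x.val y.val * (1 - inner ℂ y.val z.val))
  nlinarith

noncomputable instance : MetricSpace (KoranyiSphere k) where
  dist x y := Real.sqrt ‖(1 - inner ℂ x.val y.val : ℂ)‖
  dist_self x := by rw [inner_val_self, sub_self, norm_zero, Real.sqrt_zero]
  dist_comm x y := by rw [norm_one_sub_inner_comm]
  dist_triangle := sqrt_norm_one_sub_inner_le
  eq_of_dist_eq_zero {x y} h := by
    have h1 := (Real.sqrt_eq_zero (norm_nonneg _)).1 h
    have h2 := norm_val_sub_sq_le x y
    rw [h1, mul_zero] at h2
    have h3 : ‖x.val - y.val‖ = 0 := by nlinarith [norm_nonneg (x.val - y.val)]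
    exact val_injective (sub_eq_zero.1 (norm_eq_zero.1 h3))

theorem dist_def (x y : KoranyiSphere k) :
    dist x y = Real.sqrt ‖(1 - inner ℂ x.val y.val : ℂ)‖ := rfl

theorem dist_le_iff {x y : KoranyiSphere k} {r : ℝ} (hr : 0 ≤ r) :
    dist x y ≤ r ↔ ‖(1 - inner ℂ x.val y.val : ℂ)‖ ≤ r ^ 2 := by
  rw [dist_def, Real.sqrt_le_left hr]

/-- The two metrics are comparable up to a power: `‖x - y‖ ≤ √2 * d` and `d ^ 2 ≤ ‖x - y‖`. They
have the same Borel sets, so Euclidean surface measure can be pulled back. -/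
theorem isClosedEmbedding_val :
    Topology.IsClosedEmbedding (val : KoranyiSphere k → EuclideanSpace ℂ (Fin (k + 1))) := by
  have hl : LipschitzWith 2 (val : KoranyiSphere k → EuclideanSpace ℂ (Fin (k + 1))) := by
    refine LipschitzWith.of_dist_le_mul fun x y => ?_
    rw [dist_eq_norm (val x), dist_def]
    refine abs_le_of_sq_le_sq' ?_ (by positivity) |>.2
    refine (norm_val_sub_sq_le x y).trans ?_
    rw [mul_pow, Real.sq_sqrt (norm_nonneg _)]
    push_cast
    nlinarith [norm_nonneg (1 - inner ℂ x.val y.val : ℂ)]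
  have hrange : Set.range (val : KoranyiSphere k → EuclideanSpace ℂ (Fin (k + 1))) =
      Metric.sphere 0 1 := by
    ext x
    simp only [Set.mem_range, mem_sphere_iff_norm, sub_zero]
    exact ⟨by rintro ⟨y, rfl⟩; exact y.norm_val, fun h => ⟨ofNorm x h, rfl⟩⟩
  refine ⟨⟨⟨?_⟩, val_injective⟩, by rw [hrange]; exact Metric.isClosed_sphere⟩
  refine le_antisymm (continuous_iff_le_induced.1 hl.continuous) ?_
  rw [le_iff_nhds]
  intro x
  rw [nhds_induced]
  refine Metric.nhds_basis_ball.ge_iff.2 fun ε hε => ?_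
  refine Filter.mem_comap.2 ⟨Metric.ball x.val (ε ^ 2), Metric.ball_mem_nhds _ (by positivity),
    fun y hy => ?_⟩
  have hy' : ‖y.val - x.val‖ < ε ^ 2 := by simpa [dist_eq_norm] using hy
  rw [Metric.mem_ball, dist_comm, dist_def]
  exact (Real.sqrt_lt' hε).2 ((norm_one_sub_inner_le x.norm_val y.val).trans_lt hy')

instance : SecondCountableTopology (KoranyiSphere k) :=
  isClosedEmbedding_val.isEmbedding.secondCountableTopology

noncomputable instance : MeasurableSpace (KoranyiSphere k) := borel _

instance : BorelSpace (KoranyiSphere k) := ⟨rfl⟩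

theorem measurableEmbedding_val :
    MeasurableEmbedding (val : KoranyiSphere k → EuclideanSpace ℂ (Fin (k + 1))) :=
  isClosedEmbedding_val.measurableEmbedding

/-- The surface measure: the `(2k+1)`-dimensional Hausdorff measure of the Euclidean metric. -/
noncomputable def surface (k : ℕ) : MeasureTheory.Measure (KoranyiSphere k) :=
  MeasureTheory.Measure.comap val
    (μH[2 * ((k + 1 : ℕ) : ℝ) - 1] : MeasureTheory.Measure (EuclideanSpace ℂ (Fin (k + 1))))

theorem surface_apply (s : Set (KoranyiSphere k)) :
    surface k s = (μH[2 * ((k + 1 : ℕ) : ℝ) - 1] :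
      MeasureTheory.Measure (EuclideanSpace ℂ (Fin (k + 1)))) (val '' s) :=
  measurableEmbedding_val.comap_apply _ _

end KoranyiSphere

/-! ### Surface measure of nonisotropic balls, doubling and density points. -/

namespace KoranyiSphere

open MeasureTheory ENNReal

variable {k : ℕ}

/-- The exponent is the real dimension `2 * k + 1` of the parameter space, so this Hausdorff measure
is a Haar measure. -/
theorem exists_hausdorffMeasure_prod_eq (k : ℕ) : ∃ c : ℝ≥0∞, c ≠ 0 ∧ c ≠ ∞ ∧
    ∀ (T : Set (EuclideanSpace ℂ (Fin k))) (I : Set ℝ),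
      (μH[2 * ((k + 1 : ℕ) : ℝ) - 1] : Measure (EuclideanSpace ℂ (Fin k) × ℝ)) (T ×ˢ I) =
        c * (volume T * volume I) := by
  have hfin : ((Module.finrank ℝ (EuclideanSpace ℂ (Fin k) × ℝ) : ℕ) : ℝ) =
      2 * ((k + 1 : ℕ) : ℝ) - 1 := by
    rw [Module.finrank_prod, Module.finrank_self, finrank_real_of_complex,
      finrank_euclideanSpace_fin]
    push_cast; ring
  rw [← hfin]
  set ν : Measure (EuclideanSpace ℂ (Fin k) × ℝ) :=
    μH[Module.finrank ℝ (EuclideanSpace ℂ (Fin k) × ℝ)] with hν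
  have h := Measure.isAddLeftInvariant_eq_smul ν
    ((volume : Measure (EuclideanSpace ℂ (Fin k))).prod (volume : Measure ℝ))
  refine ⟨(Measure.addHaarScalarFactor ν
    ((volume : Measure (EuclideanSpace ℂ (Fin k))).prod (volume : Measure ℝ)) : ℝ≥0∞), ?_,
    ENNReal.coe_ne_top, fun T I => ?_⟩
  · exact_mod_cast (Measure.addHaarScalarFactor_pos_of_isAddHaarMeasure _ _).ne'
  · conv_lhs => rw [h]
    rw [Measure.smul_apply, Measure.prod_prod]
    rfl

theorem volume_closedBall_zero (k : ℕ) {r : ℝ} (hr : 0 ≤ r) :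
    volume (Metric.closedBall (0 : EuclideanSpace ℂ (Fin k)) r) =
      ENNReal.ofReal (r ^ (2 * k)) *
        volume (Metric.closedBall (0 : EuclideanSpace ℂ (Fin k)) 1) := by
  rw [Measure.addHaar_closedBall' volume _ hr, finrank_real_of_complex,
    finrank_euclideanSpace_fin]

theorem hausdorffMeasure_le_hausdorffMeasure_sphereGraph_image
    {Q : EuclideanSpace ℂ (Fin (k + 1))}
    {ι : EuclideanSpace ℂ (Fin k) →ₗᵢ[ℂ] EuclideanSpace ℂ (Fin (k + 1))} (hQ : ‖Q‖ = 1)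
    (hι : ∀ w, (inner ℂ Q (ι w) : ℂ) = 0) (s : Set (EuclideanSpace ℂ (Fin k) × ℝ)) :
    (μH[2 * ((k + 1 : ℕ) : ℝ) - 1] : Measure (EuclideanSpace ℂ (Fin k) × ℝ)) s ≤
      (μH[2 * ((k + 1 : ℕ) : ℝ) - 1] : Measure (EuclideanSpace ℂ (Fin (k + 1))))
        (sphereGraph Q ι '' s) := by
  have h := (antilipschitzWith_sphereGraph hQ hι).le_hausdorffMeasure_image
    (d := 2 * ((k + 1 : ℕ) : ℝ) - 1) (by push_cast; linarith [(Nat.cast_nonneg k : (0:ℝ) ≤ k)]) s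
  simpa using h

/-- The ball contains the graph over a box of radius `r / 2` and half-height `r ^ 2 / 4`; the
exponent is `2 * k + 2`, one more than the Euclidean dimension of the sphere. -/
theorem exists_le_surface_closedBall (k : ℕ) : ∃ C : ℝ≥0∞, C ≠ 0 ∧ C ≠ ∞ ∧
    ∀ (x : KoranyiSphere k) (r : ℝ), 0 < r → r ≤ 1 →
      C * ENNReal.ofReal (r ^ (2 * k + 2)) ≤ surface k (Metric.closedBall x r) := by
  obtain ⟨c, hc0, hct, hc⟩ := exists_hausdorffMeasure_prod_eq k
  set v := volume (Metric.closedBall (0 : EuclideanSpace ℂ (Fin k)) 1) with hv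
  have hv0 : v ≠ 0 := (Metric.measure_closedBall_pos _ _ one_pos).ne'
  have hvt : v ≠ ∞ := measure_closedBall_lt_top.ne
  refine ⟨c * (ENNReal.ofReal ((1 / 2) ^ (2 * k) * (1 / 2)) * v),
    mul_ne_zero hc0 (mul_ne_zero (by positivity) hv0),
    ENNReal.mul_ne_top hct (ENNReal.mul_ne_top ENNReal.ofReal_ne_top hvt), fun x r hr hr1 => ?_⟩
  obtain ⟨ι, hι, -⟩ := exists_linearIsometry_orthogonal x.norm_val
  have hsub : sphereGraph x.val ι ''
      (Metric.closedBall (0 : EuclideanSpace ℂ (Fin k)) (r / 2) ×ˢ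
        Set.Icc (-(r ^ 2 / 4)) (r ^ 2 / 4)) ⊆ val '' Metric.closedBall x r := by
    rintro _ ⟨⟨w, s⟩, ⟨hw, hs⟩, rfl⟩
    have hw' : ‖w‖ ≤ r / 2 := by simpa using hw
    have hs' : |s| ≤ r ^ 2 / 4 := abs_le.2 hs
    have hw2 : ‖w‖ ^ 2 ≤ r ^ 2 / 4 := by nlinarith [norm_nonneg w]
    have hs2 : s ^ 2 ≤ r ^ 2 / 4 := by
      have : |s| ≤ 1 := by nlinarith
      rw [← sq_abs]; nlinarith [abs_nonneg s]
    have hp : ‖(w, s).1‖ ^ 2 + (w, s).2 ^ 2 ≤ 1 := by simp only; nlinarith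
    refine ⟨ofNorm (sphereGraph x.val ι (w, s)) (norm_sphereGraph x.norm_val hι hp), ?_, rfl⟩
    rw [Metric.mem_closedBall, dist_comm, dist_le_iff hr.le, val_ofNorm]
    refine (norm_one_sub_inner_sphereGraph_le x.norm_val hι hp).trans ?_
    simp only; nlinarith
  rw [surface_apply]
  refine le_trans (le_of_eq ?_) ((hausdorffMeasure_le_hausdorffMeasure_sphereGraph_image
    x.norm_val hι _).trans (measure_mono hsub))
  rw [hc, volume_closedBall_zero k (by positivity), Real.volume_Icc, ← hv, mul_assoc]
  congr 1
  rw [mul_right_comm, mul_right_comm (ENNReal.ofReal _) v, ← ENNReal.ofReal_mul (by positivity),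
    ← ENNReal.ofReal_mul (by positivity)]
  congr 2
  ring

theorem exists_surface_closedBall_le (k : ℕ) : ∃ C : ℝ≥0∞, C ≠ ∞ ∧
    ∀ (x : KoranyiSphere k) (r : ℝ), 0 < r → r ≤ 1 / 4 →
      surface k (Metric.closedBall x r) ≤ C * ENNReal.ofReal (r ^ (2 * k + 2)) := by
  obtain ⟨c, hc0, hct, hc⟩ := exists_hausdorffMeasure_prod_eq k
  set v := volume (Metric.closedBall (0 : EuclideanSpace ℂ (Fin k)) 1) with hv
  have hvt : v ≠ ∞ := measure_closedBall_lt_top.ne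
  have hd : (0 : ℝ) ≤ 2 * ((k + 1 : ℕ) : ℝ) - 1 := by
    push_cast; linarith [(Nat.cast_nonneg k : (0:ℝ) ≤ k)]
  refine ⟨((6 : NNReal) : ℝ≥0∞) ^ (2 * ((k + 1 : ℕ) : ℝ) - 1) *
    (c * (ENNReal.ofReal (2 ^ (2 * k) * 2) * v)),
    ENNReal.mul_ne_top (ENNReal.rpow_ne_top_of_nonneg hd ENNReal.coe_ne_top)
    (ENNReal.mul_ne_top hct (ENNReal.mul_ne_top ENNReal.ofReal_ne_top hvt)), fun x r hr hr1 => ?_⟩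
  obtain ⟨ι, hι, hι'⟩ := exists_linearIsometry_orthogonal x.norm_val
  set B := Metric.closedBall (0 : EuclideanSpace ℂ (Fin k)) (2 * r) ×ˢ
        Set.Icc (-(r ^ 2)) (r ^ 2) with hB
  have hsub : val '' Metric.closedBall x r ⊆ sphereGraph x.val ι '' B := by
    rintro _ ⟨y, hy, rfl⟩
    rw [Metric.mem_closedBall, dist_comm, dist_le_iff hr.le] at hy
    obtain ⟨p, hp1, hp2, hp⟩ := exists_sphereGraph_eq x.norm_val hι' hι y.norm_val
      (r := r ^ 2) (by nlinarith) hy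
    refine ⟨p, ⟨?_, abs_le.1 hp2⟩, hp⟩
    rw [mem_closedBall_zero_iff]
    exact abs_le_of_sq_le_sq' (by nlinarith) (by positivity) |>.2
  have hBs : B ⊆ {p | ‖p.1‖ ^ 2 + p.2 ^ 2 ≤ 1 / 2} := by
    rintro ⟨w, s⟩ ⟨hw, hs⟩
    have hw' : ‖w‖ ≤ 2 * r := by simpa using hw
    have hs' : |s| ≤ r ^ 2 := abs_le.2 hs
    have h1 : ‖w‖ ^ 2 ≤ (1 / 2) ^ 2 := by
      have : ‖w‖ ≤ 1 / 2 := by linarith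
      gcongr
    have h2 : s ^ 2 ≤ (1 / 4) ^ 2 := by
      rw [← sq_abs]
      have : |s| ≤ 1 / 4 := by nlinarith
      gcongr
    simp only [Set.mem_ofPred_eq]
    linarith
  rw [surface_apply]
  refine (measure_mono hsub).trans ((((lipschitzOnWith_sphereGraph x.norm_val).mono
    hBs).hausdorffMeasure_image_le hd).trans (le_of_eq ?_))
  rw [hB, hc, volume_closedBall_zero k (by positivity), Real.volume_Icc, ← hv, mul_assoc (_ ^ _ : ℝ≥0∞),
    mul_assoc c]
  congr 2
  rw [mul_right_comm, mul_right_comm (ENNReal.ofReal _) v, ← ENNReal.ofReal_mul (by positivity),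
    ← ENNReal.ofReal_mul (by positivity)]
  congr 2
  ring

/-- Upper and lower bounds with the same power of `r` give doubling, hence the Lebesgue density
theorem for nonisotropic balls whose centres may be off the point. -/
instance : IsUnifLocDoublingMeasure (surface k) := by
  obtain ⟨c, hc0, hct, hc⟩ := exists_le_surface_closedBall k
  obtain ⟨C, hCt, hC⟩ := exists_surface_closedBall_le k
  have hfin : C * ENNReal.ofReal (2 ^ (2 * k + 2)) / c ≠ ∞ :=
    ENNReal.div_ne_top (ENNReal.mul_ne_top hCt ENNReal.ofReal_ne_top) hc0
  refine ⟨⟨(C * ENNReal.ofReal (2 ^ (2 * k + 2)) / c).toNNReal, ?_⟩⟩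
  filter_upwards [Ioc_mem_nhdsGT (show (0 : ℝ) < 1 / 8 by norm_num)] with r hr x
  rw [ENNReal.coe_toNNReal hfin]
  calc surface k (Metric.closedBall x (2 * r))
      ≤ C * ENNReal.ofReal ((2 * r) ^ (2 * k + 2)) :=
        hC x _ (by linarith [hr.1]) (by linarith [hr.2])
    _ = C * ENNReal.ofReal (2 ^ (2 * k + 2)) / c * (c * ENNReal.ofReal (r ^ (2 * k + 2))) := by
        rw [← mul_assoc, ENNReal.div_mul_cancel hc0 hct, mul_assoc,
          ← ENNReal.ofReal_mul (by positivity), mul_pow]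
    _ ≤ _ := by
        gcongr
        exact hc x r hr.1 (by linarith [hr.2])

instance : IsLocallyFiniteMeasure (surface k) := by
  obtain ⟨C, hCt, hC⟩ := exists_surface_closedBall_le k
  refine ⟨fun x => ⟨Metric.closedBall x (1 / 4), Metric.closedBall_mem_nhds _ (by norm_num), ?_⟩⟩
  exact (hC x _ (by norm_num) le_rfl).trans_lt
    (ENNReal.mul_lt_top hCt.lt_top ENNReal.ofReal_lt_top)

/-- Tangential holes of a set contribute to the surface measure of its complement. -/
theorem volume_mul_le_surface_diff {c : ℝ≥0∞}
    (hc : ∀ (T : Set (EuclideanSpace ℂ (Fin k))) (I : Set ℝ),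
      (μH[2 * ((k + 1 : ℕ) : ℝ) - 1] : Measure (EuclideanSpace ℂ (Fin k) × ℝ)) (T ×ˢ I) =
        c * (volume T * volume I))
    {Q : KoranyiSphere k}
    {ι : EuclideanSpace ℂ (Fin k) →ₗᵢ[ℂ] EuclideanSpace ℂ (Fin (k + 1))}
    (hι : ∀ w, (inner ℂ Q.val (ι w) : ℂ) = 0) {δ : ℝ} (hδ : 0 < δ) (hδ1 : δ ≤ 1 / 2)
    (F : Set (KoranyiSphere k)) {T : Set (EuclideanSpace ℂ (Fin k))}
    (hT : ∀ w ∈ T, ‖w‖ ^ 2 ≤ δ / 8)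
    (hTF : ∀ w ∈ T, δ / 2 < Metric.infDist (Q.val + ι w) (val '' F)) :
    c * (volume T * ENNReal.ofReal (δ / 2)) ≤
      surface k (Metric.closedBall Q (Real.sqrt δ) \ F) := by
  have hsub : sphereGraph Q.val ι '' (T ×ˢ Set.Icc (-(δ / 4)) (δ / 4)) ⊆
      val '' (Metric.closedBall Q (Real.sqrt δ) \ F) := by
    rintro _ ⟨⟨w, s⟩, ⟨hw, hs⟩, rfl⟩
    have hw2 := hT w hw
    have hs' : |s| ≤ δ / 4 := abs_le.2 hs
    have hs2 : s ^ 2 ≤ δ / 8 := by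
      rw [← sq_abs]; nlinarith [abs_nonneg s]
    have hp : ‖(w, s).1‖ ^ 2 + (w, s).2 ^ 2 ≤ 1 := by simp only; linarith
    refine ⟨ofNorm (sphereGraph Q.val ι (w, s)) (norm_sphereGraph Q.norm_val hι hp),
      ⟨?_, fun hF => ?_⟩, rfl⟩
    · rw [Metric.mem_closedBall, dist_comm, dist_le_iff (Real.sqrt_nonneg _), Real.sq_sqrt hδ.le,
        val_ofNorm]
      refine (norm_one_sub_inner_sphereGraph_le Q.norm_val hι hp).trans ?_
      simp only; linarith
    · have h1 := Metric.infDist_le_dist_of_mem (x := Q.val + ι w) (Set.mem_image_of_mem val hF)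
      have h2 := norm_sphereGraph_sub_le (ι := ι) Q.norm_val hp
      have h3 := hTF w hw
      rw [dist_comm, dist_eq_norm] at h1
      change _ ≤ ‖sphereGraph Q.val ι (w, s) - (Q.val + ι w)‖ at h1
      simp only at h2
      linarith
  rw [surface_apply]
  refine le_trans (le_of_eq ?_) ((hausdorffMeasure_le_hausdorffMeasure_sphereGraph_image
    Q.norm_val hι _).trans (measure_mono hsub))
  rw [hc, Real.volume_Icc]
  congr 3
  ring

/-- At almost every point of a measurable set the complement has small relative measure in small
nonisotropic balls with nearby centres. -/
theorem ae_forall_surface_diff_le {F : Set (KoranyiSphere k)} (hF : MeasurableSet F) (K : ℝ) :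
    ∀ᵐ P ∂(surface k).restrict F, ∀ ε : ℝ≥0∞, ε ≠ 0 → ∃ r₀ > 0, ∀ (Q : KoranyiSphere k) (r : ℝ),
      0 < r → r < r₀ → dist P Q ≤ K * r →
        surface k (Metric.closedBall Q r \ F) ≤ ε * surface k (Metric.closedBall Q r) := by
  obtain ⟨C₀, hC0, -, hC₀⟩ := exists_le_surface_closedBall k
  obtain ⟨C₁, hCt, hC₁⟩ := exists_surface_closedBall_le k
  filter_upwards [IsUnifLocDoublingMeasure.ae_tendsto_measure_inter_div (surface k) F K]
    with P hP ε hε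
  -- The truncated subtraction `1 - ε` is faithful only for `ε ≤ 1`.
  wlog hε1 : ε ≤ 1 generalizing ε
  · obtain ⟨r₀, hr₀, h⟩ := this 1 one_ne_zero le_rfl
    exact ⟨r₀, hr₀, fun Q r h1 h2 h3 => (h Q r h1 h2 h3).trans (by gcongr; exact (not_le.1 hε1).le)⟩
  let l : Filter (KoranyiSphere k × ℝ) :=
    Filter.comap Prod.snd (nhdsWithin 0 (Set.Ioi 0)) ⊓ Filter.principal {p | dist P p.1 ≤ K * p.2}
  have hl : Filter.Tendsto (Prod.snd : KoranyiSphere k × ℝ → ℝ) l (nhdsWithin 0 (Set.Ioi 0)) :=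
    Filter.tendsto_comap.mono_left inf_le_left
  have h := hP Prod.fst Prod.snd hl (by
    filter_upwards [Filter.mem_inf_of_right (Filter.mem_principal_self _)] with p hp
    exact hp)
  have h1 : ∀ᶠ p in l, 1 - ε <
      surface k (F ∩ Metric.closedBall p.1 p.2) / surface k (Metric.closedBall p.1 p.2) :=
    h.eventually_const_lt (ENNReal.sub_lt_self one_ne_top one_ne_zero hε)
  rw [Filter.eventually_inf_principal, Filter.eventually_comap] at h1
  obtain ⟨r₁, hr₁, hr⟩ := (mem_nhdsGT_iff_exists_Ioo_subset).1 h1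
  refine ⟨min r₁ (1 / 4), lt_min hr₁ (by norm_num), fun Q r h2 h3 h4 => ?_⟩
  have h5 := hr ⟨h2, h3.trans_le (min_le_left _ _)⟩ (Q, r) rfl h4
  have hr4 : r ≤ 1 / 4 := h3.le.trans (min_le_right _ _)
  simp only at h5
  set m := surface k (Metric.closedBall Q r) with hm
  have hm0 : m ≠ 0 := by
    refine (lt_of_lt_of_le ?_ (hC₀ Q r h2 (by linarith))).ne'
    exact ENNReal.mul_pos hC0 (by positivity)
  have hmt : m ≠ ∞ := ((hC₁ Q r h2 hr4).trans_lt
    (ENNReal.mul_lt_top hCt.lt_top ENNReal.ofReal_lt_top)).ne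
  rw [ENNReal.lt_div_iff_mul_lt (Or.inl hm0) (Or.inl hmt)] at h5
  have h6 := measure_sdiff_add_inter (μ := surface k) (Metric.closedBall Q r) hF
  rw [Set.inter_comm, ← hm] at h6
  have h7 : surface k (F ∩ Metric.closedBall Q r) ≠ ∞ :=
    ne_top_of_le_ne_top hmt (measure_mono Set.inter_subset_right)
  have h8 : ε * m + (1 - ε) * m = m := by
    rw [← add_mul, add_tsub_cancel_of_le hε1, one_mul]
  refine (ENNReal.add_le_add_iff_right h7).1 ?_
  rw [h6]
  nth_rw 1 [← h8]
  gcongr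

end KoranyiSphere

/-! ### Tangential circles that mostly stay near the set. -/

section
open MeasureTheory ENNReal
variable {k : ℕ}

theorem setIntegral_closedBall_comp_smul (χ : EuclideanSpace ℂ (Fin k) → ℝ) (ρ : ℝ) {l : ℂ}
    (hl : ‖l‖ = 1) : ∫ w in Metric.closedBall (0 : EuclideanSpace ℂ (Fin k)) ρ, χ (l • w) =
      ∫ w in Metric.closedBall (0 : EuclideanSpace ℂ (Fin k)) ρ, χ w := by
  have hl0 : l ≠ 0 := by rintro rfl; simp at hl
  let e : EuclideanSpace ℂ (Fin k) ≃ₗᵢ[ℝ] EuclideanSpace ℂ (Fin k) :=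
    ⟨(LinearEquiv.smulOfNeZero ℂ (EuclideanSpace ℂ (Fin k)) l hl0).restrictScalars ℝ, fun w => by
      change ‖l • w‖ = ‖w‖
      rw [norm_smul, hl, one_mul]⟩
  have he : ∀ w, e w = l • w := fun _ => rfl
  have h := e.measurePreserving.setIntegral_preimage_emb
    e.toHomeomorph.measurableEmbedding χ (Metric.closedBall 0 ρ)
  have hpre : e ⁻¹' Metric.closedBall 0 ρ = Metric.closedBall 0 ρ := by
    ext w; simp
  rw [hpre] at h
  exact h

/-- If a function with values in `[0, 1]` vanishes on most of a ball, then its average over some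
circle in the ball is small. -/
theorem exists_circleAverage_smul_le {χ : EuclideanSpace ℂ (Fin k) → ℝ} (hχ : Continuous χ)
    (h1 : ∀ w, χ w ≤ 1) {ρ a : ℝ} (hρ : 0 < ρ) (ha : 0 ≤ a)
    {T : Set (EuclideanSpace ℂ (Fin k))}
    (hT : ∀ w ∈ Metric.closedBall 0 ρ, w ∉ T → χ w ≤ 0) (hTm : MeasurableSet T)
    (hTa : volume T ≤ ENNReal.ofReal a * volume (Metric.closedBall
      (0 : EuclideanSpace ℂ (Fin k)) ρ)) :
    ∃ w ∈ Metric.closedBall (0 : EuclideanSpace ℂ (Fin k)) ρ,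
      Real.circleAverage (fun l => χ (l • w)) 0 1 ≤ a := by
  set B := Metric.closedBall (0 : EuclideanSpace ℂ (Fin k)) ρ with hB
  have hB0 : volume B ≠ 0 := (Metric.measure_closedBall_pos _ _ hρ).ne'
  have hBt : volume B ≠ ∞ := measure_closedBall_lt_top.ne
  have hjoint : Continuous (Function.uncurry fun (w : EuclideanSpace ℂ (Fin k)) (t : ℝ) =>
      χ (circleMap 0 1 t • w)) := by
    have : Continuous (fun p : EuclideanSpace ℂ (Fin k) × ℝ => circleMap 0 1 p.2) :=
      (continuous_circleMap 0 1).comp continuous_snd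
    exact hχ.comp (this.smul continuous_fst)
  have hG : Continuous fun w : EuclideanSpace ℂ (Fin k) =>
      Real.circleAverage (fun l => χ (l • w)) 0 1 := by
    simp only [Real.circleAverage_def]
    have := intervalIntegral.continuous_parametric_intervalIntegral_of_continuous' (μ := volume)
      hjoint 0 (2 * Real.pi)
    exact this.const_smul (2 * Real.pi)⁻¹
  have hcB : IsCompact B := isCompact_closedBall _ _
  obtain ⟨w, hw, hwle⟩ := exists_le_setAverage hB0 hBt (hG.continuousOn.integrableOn_compact hcB)
  refine ⟨w, hw, hwle.trans ?_⟩
  -- Unit scalars preserve the ball and its volume, so by Fubini averaging over circles does not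
  -- change the integral.
  have hint : ∫ w in B, Real.circleAverage (fun l => χ (l • w)) 0 1 = ∫ w in B, χ w := by
    simp only [Real.circleAverage_def, smul_eq_mul]
    rw [integral_const_mul]
    have hswap : ∫ w in B, ∫ t in (0 : ℝ)..2 * Real.pi, χ (circleMap 0 1 t • w) =
        ∫ t in (0 : ℝ)..2 * Real.pi, ∫ w in B, χ (circleMap 0 1 t • w) := by
      simp only [intervalIntegral.integral_of_le Real.two_pi_pos.le]
      refine integral_integral_swap (f := fun (w : EuclideanSpace ℂ (Fin k)) (t : ℝ) =>
        χ (circleMap 0 1 t • w)) ?_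
      rw [Measure.prod_restrict]
      refine IntegrableOn.mono_set ?_ (Set.prod_mono_right Set.Ioc_subset_Icc_self)
      exact hjoint.continuousOn.integrableOn_compact (hcB.prod isCompact_Icc)
    rw [hswap]
    have : ∀ t : ℝ, ∫ w in B, χ (circleMap 0 1 t • w) = ∫ w in B, χ w := fun t =>
      setIntegral_closedBall_comp_smul χ ρ (by simp)
    simp only [this, intervalIntegral.integral_const, smul_eq_mul, sub_zero]
    rw [← mul_assoc, inv_mul_cancel₀ Real.two_pi_pos.ne', one_mul]
  have hle : ∫ w in B, χ w ≤ (volume : Measure (EuclideanSpace ℂ (Fin k))).real T := by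
    have hTt : volume T ≠ ∞ := ne_top_of_le_ne_top (ENNReal.mul_ne_top ofReal_ne_top hBt) hTa
    calc ∫ w in B, χ w ≤ ∫ w in B, T.indicator (fun _ => (1 : ℝ)) w := by
          refine setIntegral_mono_on (hχ.continuousOn.integrableOn_compact hcB) ?_
            hcB.measurableSet fun w hw => ?_
          · exact ((integrable_indicator_iff hTm).2 (integrableOn_const hTt)).integrableOn
          · by_cases h : w ∈ T
            · rw [Set.indicator_of_mem h]; exact h1 w
            · rw [Set.indicator_of_notMem h]; exact hT w hw h
      _ ≤ ∫ w, T.indicator (fun _ => (1 : ℝ)) w := by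
          refine setIntegral_le_integral ((integrable_indicator_iff hTm).2
            (integrableOn_const hTt)) ?_
          exact Filter.Eventually.of_forall fun w => Set.indicator_nonneg (fun _ _ => zero_le_one) w
      _ = _ := by rw [integral_indicator_const _ hTm, smul_eq_mul, mul_one]
  have hTa' : (volume : Measure (EuclideanSpace ℂ (Fin k))).real T ≤
      a * (volume : Measure (EuclideanSpace ℂ (Fin k))).real B := by
    have := ENNReal.toReal_mono (ENNReal.mul_ne_top ofReal_ne_top hBt) hTa
    rwa [ENNReal.toReal_mul, ENNReal.toReal_ofReal ha] at this
  rw [setAverage_eq, smul_eq_mul, hint]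
  refine (inv_mul_le_iff₀ (ENNReal.toReal_pos hB0 hBt)).2 ?_
  rw [mul_comm]
  exact hle.trans hTa'

namespace KoranyiSphere

/-- Almost every point of a closed set admits, over nearby points, small complex tangential
circles which mostly stay close to the set. -/
theorem ae_exists_tangential_circle {F : Set (KoranyiSphere k)} (hF : MeasurableSet F) {γ : ℝ}
    (hγ : 0 < γ) (hγ1 : γ ≤ 1 / 10) :
    ∀ᵐ P ∂(surface k).restrict F, ∃ h₀ > 0, ∀ (Q : KoranyiSphere k) (h : ℝ), 0 < h → h < h₀ →
      ‖(1 - inner ℂ P.val Q.val : ℂ)‖ ≤ 17 * h →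
      ∃ v : EuclideanSpace ℂ (Fin (k + 1)), (inner ℂ Q.val v : ℂ) = 0 ∧
        ‖v‖ ^ 2 ≤ γ ^ 2 / 1000 * h ∧
        Real.circleAverage (fun l => max 0 (min 1
          (2 * Metric.infDist (Q.val + l • v) (val '' F) / (γ * h) - 1))) 0 1 ≤ 1 / 200 := by
  obtain ⟨c, hc0, hct, hc⟩ := exists_hausdorffMeasure_prod_eq k
  obtain ⟨C, hCt, hC⟩ := exists_surface_closedBall_le k
  set v₁ := volume (Metric.closedBall (0 : EuclideanSpace ℂ (Fin k)) 1) with hv₁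
  have hv0 : v₁ ≠ 0 := (Metric.measure_closedBall_pos _ _ one_pos).ne'
  -- Times `δ ^ k`, this is `c / 200` times the volume of the ball of radius `ρ` below, as `ρ ^ 2 =
  -- γ / 1000 * δ`; `ε` is chosen to bring the holes below that size.
  set A : ℝ≥0∞ := c * (ENNReal.ofReal (1 / 200) * (ENNReal.ofReal ((γ / 1000) ^ k) * v₁)) with hA
  have hA0 : A ≠ 0 := mul_ne_zero hc0 (mul_ne_zero (by positivity)
    (mul_ne_zero (by positivity) hv0))
  have hCC : (C + 1) * 2 ≠ ∞ :=
    ENNReal.mul_ne_top (ENNReal.add_ne_top.2 ⟨hCt, one_ne_top⟩) ENNReal.ofNat_ne_top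
  set ε : ℝ≥0∞ := A / ((C + 1) * 2) with hε
  have hε0 : ε ≠ 0 := (ENNReal.div_pos hA0 hCC).ne'
  have hεC : ε * C * 2 ≤ A := by
    calc ε * C * 2 ≤ ε * ((C + 1) * 2) := by rw [mul_assoc]; gcongr; exact le_self_add
      _ = A := ENNReal.div_mul_cancel (by simp) hCC
  -- The balls have radius `√(γ * h)`, and `dist P Q ≤ √(17 * h) = √(17 / γ) * √(γ * h)`.
  filter_upwards [ae_forall_surface_diff_le hF (Real.sqrt (17 / γ))] with P hP
  obtain ⟨r₀, hr₀, hr⟩ := hP ε hε0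
  refine ⟨min (r₀ ^ 2 / γ) (1 / 2), lt_min (by positivity) (by norm_num),
    fun Q h hh hh0 hPQ => ?_⟩
  obtain ⟨ι, hι, -⟩ := exists_linearIsometry_orthogonal Q.norm_val
  have hh1 : γ * h < r₀ ^ 2 := by
    rw [mul_comm]; exact (lt_div_iff₀ hγ).1 (hh0.trans_le (min_le_left _ _))
  have hh2 : h < 1 / 2 := hh0.trans_le (min_le_right _ _)
  set δ := γ * h with hδ
  have hδ0 : 0 < δ := mul_pos hγ hh
  have hδ1 : δ < 1 / 16 := by nlinarith
  have hdiff := hr Q (Real.sqrt δ) (Real.sqrt_pos.2 hδ0) ((Real.sqrt_lt' hr₀).2 hh1) (by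
    rw [dist_def, ← Real.sqrt_mul (by positivity)]
    refine Real.sqrt_le_sqrt (hPQ.trans (le_of_eq ?_))
    rw [hδ]; field_simp)
  set ρ := Real.sqrt (γ ^ 2 / 1000 * h) with hρ
  have hρ2 : ρ ^ 2 = γ ^ 2 / 1000 * h := Real.sq_sqrt (by positivity)
  have hρ0 : 0 < ρ := Real.sqrt_pos.2 (by positivity)
  set T : Set (EuclideanSpace ℂ (Fin k)) := {w | w ∈ Metric.closedBall 0 ρ ∧
    δ / 2 < Metric.infDist (Q.val + ι w) (val '' F)} with hT
  have hcont : Continuous fun w => Metric.infDist (Q.val + ι w) (val '' F) :=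
    (Metric.continuous_infDist_pt _).comp (continuous_const.add ι.continuous)
  have hTm : MeasurableSet T := Metric.isClosed_closedBall.measurableSet.inter
    (measurableSet_lt measurable_const hcont.measurable)
  have hTvol := volume_mul_le_surface_diff hc hι hδ0 (by linarith) F (T := T)
    (fun w hw => by
      have : ‖w‖ ≤ ρ := by simpa using hw.1
      have h2 : ‖w‖ ^ 2 ≤ ρ ^ 2 := by gcongr
      nlinarith) (fun w hw => hw.2)
  have hball := hC Q (Real.sqrt δ) (Real.sqrt_pos.2 hδ0)
    ((Real.sqrt_le_left (by norm_num)).2 (by linarith))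
  -- The factor `δ / 2` is the length of the interval over each hole and cancels.
  have hpow : (Real.sqrt δ) ^ (2 * k + 2) = (2 * δ ^ k) * (δ / 2) := by
    have : (Real.sqrt δ) ^ (2 * k + 2) = ((Real.sqrt δ) ^ 2) ^ (k + 1) := by ring
    rw [this, Real.sq_sqrt hδ0.le]; ring
  have hρk : ρ ^ (2 * k) = (γ / 1000) ^ k * δ ^ k := by
    rw [pow_mul, hρ2, ← mul_pow]; congr 1; rw [hδ]; ring
  have hTa : volume T ≤ ENNReal.ofReal (1 / 200) *
      volume (Metric.closedBall (0 : EuclideanSpace ℂ (Fin k)) ρ) := by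
    rw [KoranyiSphere.volume_closedBall_zero k hρ0.le, hρk, ← hv₁]
    have h1 : c * (volume T * ENNReal.ofReal (δ / 2)) ≤
        ε * (C * ENNReal.ofReal ((2 * δ ^ k) * (δ / 2))) := by
      rw [← hpow]
      exact hTvol.trans (hdiff.trans (by gcongr))
    rw [ENNReal.ofReal_mul (by positivity), ← mul_assoc, ← mul_assoc, ← mul_assoc] at h1
    have h2 := (ENNReal.mul_le_mul_iff_left (ENNReal.ofReal_pos.2 (half_pos hδ0)).ne'
      ENNReal.ofReal_ne_top).1 h1
    rw [ENNReal.ofReal_mul zero_le_two, ENNReal.ofReal_ofNat, ← mul_assoc] at h2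
    have h3 : c * volume T ≤ A * ENNReal.ofReal (δ ^ k) := h2.trans (by gcongr)
    rw [hA, mul_assoc c] at h3
    refine ((ENNReal.mul_le_mul_iff_right hc0 hct).1 h3).trans (le_of_eq ?_)
    rw [ENNReal.ofReal_mul (by positivity)]
    ring
  obtain ⟨w, hw, hwa⟩ := exists_circleAverage_smul_le
    (χ := fun w => max 0 (min 1 (2 * Metric.infDist (Q.val + ι w) (val '' F) / δ - 1)))
    (continuous_const.max (continuous_const.min
      (((continuous_const.mul hcont).div_const _).sub continuous_const)))
    (fun w => max_le zero_le_one (min_le_left _ _)) hρ0 (by norm_num : (0 : ℝ) ≤ 1 / 200)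
    (T := T) (fun w hw hwT => by
      refine max_le le_rfl ((min_le_right _ _).trans ?_)
      have h1 : Metric.infDist (Q.val + ι w) (val '' F) ≤ δ / 2 := not_lt.1 fun h => hwT ⟨hw, h⟩
      rw [sub_nonpos, div_le_one hδ0]; linarith) hTm hTa
  refine ⟨ι w, hι w, ?_, ?_⟩
  · rw [ι.norm_map, ← hρ2]
    have : ‖w‖ ≤ ρ := by simpa using hw
    gcongr
  · simpa only [map_smul] using hwa

end KoranyiSphere
end

/-! ### Iteration of the disc argument and passage to almost every point. -/

section
open MeasureTheory KoranyiSphere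
variable {k : ℕ}

/-- The iterated disc argument at a point with small complex tangential circles near `F`. -/
theorem admissiblyBoundedAt_of_tangential_circle {f : EuclideanSpace ℂ (Fin (k + 1)) → ℂ}
    (hf : DifferentiableOn ℂ f (Metric.ball 0 1)) {F : Set (KoranyiSphere k)} {α γ M : ℝ}
    (hFne : F.Nonempty) (hγ : 0 < γ) (hγ1 : γ ≤ 1 / 10) (hγα : 20 * γ ≤ α - 1)
    (hM : ∀ R ∈ F, ∀ z ∈ stolzRegion α R.val, ‖f z‖ ≤ M) {P : KoranyiSphere k}
    (hP : ∃ h₀ > 0, ∀ (Q : KoranyiSphere k) (h : ℝ), 0 < h → h < h₀ →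
      ‖(1 - inner ℂ P.val Q.val : ℂ)‖ ≤ 17 * h →
      ∃ v : EuclideanSpace ℂ (Fin (k + 1)), (inner ℂ Q.val v : ℂ) = 0 ∧
        ‖v‖ ^ 2 ≤ γ ^ 2 / 1000 * h ∧
        Real.circleAverage (fun l => max 0 (min 1
          (2 * Metric.infDist (Q.val + l • v) (val '' F) / (γ * h) - 1))) 0 1 ≤ 1 / 200) :
    AdmissiblyBoundedAt f P.val := by
  obtain ⟨h₀, hh₀, hP⟩ := hP
  have hcompact : ∀ h : ℝ, 0 < h → ∃ K : ℝ, ∀ z, h ≤ 1 - ‖z‖ → ‖f z‖ ≤ K := by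
    intro h hh
    have hsub : Metric.closedBall (0 : EuclideanSpace ℂ (Fin (k + 1))) (1 - h) ⊆
        Metric.ball 0 1 := Metric.closedBall_subset_ball (by linarith)
    obtain ⟨K, hK⟩ := (isCompact_closedBall (0 : EuclideanSpace ℂ (Fin (k + 1)))
      (1 - h)).exists_bound_of_continuousOn (hf.continuousOn.mono hsub)
    exact ⟨K, fun z hz => hK z (by rw [mem_closedBall_zero_iff]; linarith)⟩
  set h₁ := min (h₀ / 2) (γ / 1000) with hh₁
  have hh₁0 : 0 < h₁ := lt_min (by linarith) (by linarith)
  obtain ⟨K₁, hK₁⟩ := hcompact h₁ hh₁0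
  set M' := max M K₁ with hM'
  refine ⟨16, by norm_num, M', fun z₁ hz₁ => ?_⟩
  have hz₁1 : ‖z₁‖ < 1 := by simpa using hz₁.1
  set t := 1 - ‖z₁‖ with ht
  have ht0 : 0 < t := by linarith
  obtain ⟨K, hK⟩ := hcompact t ht0
  -- This excess depends on the height `t`, but the final bound `M'` does not, since the excess is
  -- halved indefinitely.
  set D := max 0 (K - M') with hD
  have hD0 : 0 ≤ D := le_max_left _ _
  have key : ∀ j : ℕ, ∀ z : EuclideanSpace ℂ (Fin (k + 1)), ‖z‖ < 1 →
      ‖(1 - inner ℂ P.val z : ℂ)‖ < 16 * (1 - ‖z‖) → t ≤ 1 - ‖z‖ → ‖f z‖ ≤ M' + D / 2 ^ j := by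
    intro j
    induction j with
    | zero =>
      intro z _ _ hz
      have h1 := hK z hz
      have h2 : K - M' ≤ D := le_max_right _ _
      rw [pow_zero, div_one]; linarith
    | succ j ih =>
      intro z hz1 hzP hzt
      set h := 1 - ‖z‖ with hh
      have hh0 : 0 < h := by linarith
      have hDj : 0 ≤ D / 2 ^ j := by positivity
      by_cases hh1 : h₁ ≤ h
      · refine ((hK₁ z hh1).trans (le_max_right M K₁)).trans ?_
        have : 0 ≤ D / 2 ^ (j + 1) := by positivity
        linarith
      rw [not_le] at hh1
      have hhγ : h ≤ γ / 1000 := hh1.le.trans (min_le_right _ _)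
      have hhh₀ : h < h₀ := by
        have := hh1.trans_le (min_le_left (h₀ / 2) (γ / 1000))
        linarith
      have hzn : 0 < ‖z‖ := by linarith
      let Q : KoranyiSphere k := ofNorm (((‖z‖⁻¹ : ℝ) : ℂ) • z) (by
        rw [norm_smul, Complex.norm_real, norm_inv, norm_norm, inv_mul_cancel₀ hzn.ne'])
      have hzQ : (1 - h : ℂ) • Q.val = z := by
        rw [val_ofNorm, smul_smul, hh]
        push_cast
        rw [sub_sub_cancel, mul_inv_cancel₀ (by exact_mod_cast hzn.ne'), one_smul]
      have hPQ : ‖(1 - inner ℂ P.val Q.val : ℂ)‖ ≤ 17 * h := by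
        have e : (1 - inner ℂ P.val Q.val : ℂ) = (1 - inner ℂ P.val z) -
            h * inner ℂ P.val Q.val := by
          rw [← hzQ, inner_smul_right]; ring
        rw [e]
        refine (norm_sub_le _ _).trans ?_
        have h7 : ‖(h * inner ℂ P.val Q.val : ℂ)‖ ≤ h * 1 := by
          rw [norm_mul, Complex.norm_real, Real.norm_eq_abs, abs_of_pos hh0]
          gcongr
          simpa [P.norm_val, Q.norm_val] using norm_inner_le_norm (𝕜 := ℂ) P.val Q.val
        linarith
      obtain ⟨v, hQv, hv, hχ⟩ := hP Q h hh0 hhh₀ hPQ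
      set χ : ℂ → ℝ := fun l => max 0 (min 1
          (2 * Metric.infDist (Q.val + l • v) (val '' F) / (γ * h) - 1)) with hχdef
      have hχc : Continuous χ := by
        have : Continuous fun l : ℂ => Metric.infDist (Q.val + l • v) (val '' F) :=
          (Metric.continuous_infDist_pt _).comp (by fun_prop)
        exact continuous_const.max (continuous_const.min
          (((continuous_const.mul this).div_const _).sub continuous_const))
      obtain ⟨q, hq, hqpos, hqχ, hq0, hqa⟩ := exists_entire_re_majorant hχc
        (fun l => le_max_left _ _) (by norm_num : (0 : ℝ) < 1 / 200)
      have hstep := norm_le_of_disc (F := val '' F) (α := α) (M := M') (D := D / 2 ^ j)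
        (a := (q 0).re) (q := q) (γ := γ) (h := h) hf P.norm_val Q.norm_val hQv hDj hγ hγ1 hγα
        hh0 hhγ hv
        (by rw [hzQ]; exact hzP)
        (by
          rintro y hy ⟨_, ⟨R, hR, rfl⟩, hyR⟩
          exact (hM R hR y ⟨by simpa using hy, hyR⟩).trans (le_max_left _ _))
        (fun y hy hyP hyh => ih y hy hyP (hzt.trans hyh))
        hq (Complex.ext rfl (by simpa using hq0)) (hqpos 0 (by simp)) (by linarith) hqpos
        (by
          intro l hl hql
          -- The cutoff equals 1 wherever the distance to `F` is at least `γ * h`, so `‖q l‖ < 1`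
          -- forces a nearby point of `F`.
          have h1 : χ l < 1 := (hqχ l hl).trans_lt ((Complex.re_le_norm _).trans_lt hql)
          have h2 : 2 * Metric.infDist (Q.val + l • v) (val '' F) / (γ * h) - 1 < 1 := by
            have := (le_max_right _ _).trans_lt h1
            exact (min_lt_iff.1 this).resolve_left (lt_irrefl _)
          have hγh : 0 < γ * h := mul_pos hγ hh0
          have h3 : Metric.infDist (Q.val + l • v) (val '' F) < γ * h := by
            rw [sub_lt_iff_lt_add, div_lt_iff₀ hγh] at h2
            linarith
          obtain ⟨R, hR, hRd⟩ := (Metric.infDist_lt_iff (hFne.image val)).1 h3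
          exact ⟨R, hR, by rw [← dist_eq_norm, dist_comm]; exact hRd.le⟩)
      rw [hzQ] at hstep
      rw [pow_succ, ← div_div]
      exact hstep
  have hPz : ‖(1 - inner ℂ P.val z₁ : ℂ)‖ < 16 * (1 - ‖z₁‖) := by
    rw [← sum_mul_conj_eq_inner]; exact hz₁.2
  have hlim : Filter.Tendsto (fun j : ℕ => M' + D / 2 ^ j) Filter.atTop (nhds (M' + 0)) :=
    (tendsto_const_nhds.div_atTop (tendsto_pow_atTop_atTop_of_one_lt one_lt_two)).const_add M'
  have := ge_of_tendsto' hlim fun j => key j z₁ hz₁1 hPz le_rfl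
  rwa [add_zero] at this

/-- Uniform nontangential boundedness over a closed set implies admissible boundedness at almost
all of its points. -/
theorem ae_admissiblyBoundedAt_of_isClosed {f : EuclideanSpace ℂ (Fin (k + 1)) → ℂ}
    (hf : DifferentiableOn ℂ f (Metric.ball 0 1)) {F : Set (EuclideanSpace ℂ (Fin (k + 1)))}
    (hF : IsClosed F) (hFS : ∀ P ∈ F, ‖P‖ = 1) {α M : ℝ} (hα : 1 < α)
    (hM : ∀ P ∈ F, ∀ z ∈ stolzRegion α P, ‖f z‖ ≤ M) :
    ∀ᵐ P ∂(μH[2 * ((k + 1 : ℕ) : ℝ) - 1] : Measure (EuclideanSpace ℂ (Fin (k + 1)))),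
      P ∈ F → AdmissiblyBoundedAt f P := by
  have hFm : MeasurableSet (val ⁻¹' F : Set (KoranyiSphere k)) :=
    measurableEmbedding_val.measurable hF.measurableSet
  have hγ : 0 < min ((α - 1) / 20) (1 / 10) := lt_min (by linarith) (by norm_num)
  have h := ae_exists_tangential_circle hFm hγ (min_le_right _ _)
  rw [ae_restrict_iff' hFm] at h
  have h2 : ∀ᵐ x ∂surface k, x ∈ (val ⁻¹' F : Set (KoranyiSphere k)) →
      AdmissiblyBoundedAt f x.val := by
    filter_upwards [h] with x hx hxF
    exact admissiblyBoundedAt_of_tangential_circle hf ⟨x, hxF⟩ hγ (min_le_right _ _)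
      (by linarith [min_le_left ((α - 1) / 20) (1 / 10)]) (fun R hR => hM R.val hR) (hx hxF)
  rw [ae_iff, surface_apply] at h2
  rw [ae_iff]
  refine measure_mono_null (fun P hP => ?_) h2
  have hP' : ¬ (P ∈ F → AdmissiblyBoundedAt f P) := hP
  rw [Classical.not_imp] at hP'
  exact ⟨ofNorm P (hFS P hP'.1), fun hx => hP'.2 (hx hP'.1), rfl⟩

/-- For fixed `z`, membership in the Stolz region at `P` is an open condition on `P`, so a violation
of the bound persists nearby. -/
theorem isClosed_setOf_norm_le_on_stolzRegion {n : ℕ} (f : EuclideanSpace ℂ (Fin n) → ℂ)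
    (α M : ℝ) : IsClosed {P : EuclideanSpace ℂ (Fin n) | ‖P‖ = 1 ∧
      ∀ z ∈ stolzRegion α P, ‖f z‖ ≤ M} := by
  have h1 : IsClosed {P : EuclideanSpace ℂ (Fin n) | ‖P‖ = 1} :=
    isClosed_eq continuous_norm continuous_const
  suffices h2 : IsClosed {P : EuclideanSpace ℂ (Fin n) | ∀ z ∈ stolzRegion α P, ‖f z‖ ≤ M} from
    h1.inter h2
  rw [← isOpen_compl_iff, Metric.isOpen_iff]
  intro P hP
  have hP' : ¬ ∀ z ∈ stolzRegion α P, ‖f z‖ ≤ M := hP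
  push Not at hP'
  obtain ⟨z, hz, hfz⟩ := hP'
  have hopen : IsOpen {R : EuclideanSpace ℂ (Fin n) | ‖z - R‖ < α * (1 - ‖z‖)} :=
    isOpen_lt (by fun_prop) continuous_const
  obtain ⟨ε, hε, hsub⟩ := Metric.isOpen_iff.1 hopen P hz.2
  exact ⟨ε, hε, fun R hR hall => absurd (hall z ⟨hz.1, hsub hR⟩) (not_le.2 hfz)⟩

theorem ae_nontangentiallyBoundedAt_imp_admissiblyBoundedAt
    {f : EuclideanSpace ℂ (Fin (k + 1)) → ℂ} (hf : DifferentiableOn ℂ f (Metric.ball 0 1)) :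
    ∀ᵐ P ∂(μH[2 * ((k + 1 : ℕ) : ℝ) - 1] : Measure (EuclideanSpace ℂ (Fin (k + 1)))),
      ‖P‖ = 1 → NontangentiallyBoundedAt f P → AdmissiblyBoundedAt f P := by
  have h : ∀ j : ℕ, ∀ᵐ P ∂(μH[2 * ((k + 1 : ℕ) : ℝ) - 1] :
      Measure (EuclideanSpace ℂ (Fin (k + 1)))),
      P ∈ {P : EuclideanSpace ℂ (Fin (k + 1)) | ‖P‖ = 1 ∧
        ∀ z ∈ stolzRegion (1 + 1 / ((j : ℝ) + 1)) P, ‖f z‖ ≤ j} → AdmissiblyBoundedAt f P :=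
    fun j => ae_admissiblyBoundedAt_of_isClosed hf (isClosed_setOf_norm_le_on_stolzRegion f _ _)
      (fun P hP => hP.1) (lt_add_of_pos_right 1 (by positivity)) fun P hP => hP.2
  -- One index `j` serves as bound and controls the aperture: raising it weakens the bound and
  -- shrinks the region.
  filter_upwards [ae_all_iff.2 h] with P hP hP1 ⟨α, hα, M, hM⟩
  obtain ⟨j₁, hj₁⟩ := exists_nat_gt M
  obtain ⟨j₂, hj₂⟩ := exists_nat_one_div_lt (sub_pos.2 hα)
  refine hP (max j₁ j₂) ⟨hP1, fun z hz => ?_⟩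
  refine (hM z ⟨hz.1, hz.2.trans_le ?_⟩).trans (hj₁.le.trans (by exact_mod_cast le_max_left _ _))
  have hz1 : ‖z‖ < 1 := by simpa using hz.1
  have h1 : (1 : ℝ) / (((max j₁ j₂ : ℕ) : ℝ) + 1) ≤ 1 / ((j₂ : ℝ) + 1) := by
    gcongr
    exact le_max_right _ _
  have h2 : 1 + 1 / (((max j₁ j₂ : ℕ) : ℝ) + 1) ≤ α := by linarith
  exact mul_le_mul_of_nonneg_right h2 (by linarith)

end

theorem theorem5 (n : ℕ) (hn : 1 < n) :
    (∀ f : EuclideanSpace ℂ (Fin n) → ℂ,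
      DifferentiableOn ℂ f (Metric.ball (0 : EuclideanSpace ℂ (Fin n)) 1) →
      ∀ E : Set (EuclideanSpace ℂ (Fin n)),
        E ⊆ Metric.sphere (0 : EuclideanSpace ℂ (Fin n)) 1 →
        0 < (μH[2 * (n : ℝ) - 1] : MeasureTheory.Measure (EuclideanSpace ℂ (Fin n))) E →
        ((∀ᵐ P ∂(μH[2 * (n : ℝ) - 1] : MeasureTheory.Measure (EuclideanSpace ℂ (Fin n))),
            P ∈ E → NontangentiallyBoundedAt f P) ↔
          (∀ᵐ P ∂(μH[2 * (n : ℝ) - 1] : MeasureTheory.Measure (EuclideanSpace ℂ (Fin n))),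
            P ∈ E → AdmissiblyBoundedAt f P))) ∧
    (∀ P ∈ Metric.sphere (0 : EuclideanSpace ℂ (Fin n)) 1,
      ∃ f : EuclideanSpace ℂ (Fin n) → ℂ,
        DifferentiableOn ℂ f (Metric.ball (0 : EuclideanSpace ℂ (Fin n)) 1) ∧
        NontangentiallyBoundedAt f P ∧ ¬ AdmissiblyBoundedAt f P) := by
  refine ⟨fun f hf E hE _ => ⟨fun h => ?_, fun h => ?_⟩, fun P hP =>
    exists_nontangentiallyBoundedAt_not_admissiblyBoundedAt hn (by simpa using hP)⟩
  · obtain ⟨k, rfl⟩ := Nat.exists_eq_add_of_lt (zero_lt_one.trans hn)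
    rw [zero_add] at *
    filter_upwards [h, ae_nontangentiallyBoundedAt_imp_admissiblyBoundedAt hf] with P h1 h2 hP
    exact h2 (by simpa using hE hP) (h1 hP)
  · filter_upwards [h] with P h1 hP
    exact (h1 hP).nontangentiallyBoundedAt (by simpa using hE hP)
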